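/- Let $\mu,m,T>0$. Let $q:[-T,T]\to\mathbb{C}$ be continuous with $q(0)=0$, $q(t)\neq 0$ for $t\in[-T,0)\cup(0,T]$, $q([-T,T])\subset(-\infty,0]$, and $\ddot q=-\mu q/|q|^3$ on $[-T,0)\cup(0,T]$ (one-sided derivatives at $\pm T$); that is, $q$ is a Kepler motion on the negative real axis around a fixed center of mass $\mu$ at the origin, colliding with it exactly at $t=0$. Let $A,A_0\subset\{x+iy\in\mathbb{C}:y\ge 0\}$ be closed and disjoint, and let $$\Omega^{-T,0}_{A,A_0}=\{x\in H^1([-T,0],\mathbb{C}) : x(-T)\in A,\ x(0)\in A_0\},$$ $$\mathcal{A}_{-T,0}(x)=\int_{-T}^{0}\Big(\tfrac12|\dot x|^2+\frac{\mu}{|x|}+\frac{m}{|x-q(t)|}\Big)\,dt\in[0,+\infty].$$ Let $z$ be a minimizer of $\mathcal{A}_{-T,0}$ on $\Omega^{-T,0}_{A,A_0}$, and suppose that $z$ has a three-body collision at $t=0$, i.e. $z(0)=0$ $(=q(0))$. Put $a(t)=|z(t)|/|q(t)|$. Then there exist $\epsilon\in(0,T)$ and constants $0<c_a<C_a<+\infty$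 such that $c_a<a(t)<C_a$ for all $t\in(-\epsilon,0)$. -/

import Mathlib

namespace OneCenterTwoBody

/-- `q` is a collision Kepler system on `[-T, T]`, the attracting center of mass `μ` being fixed at
the origin: `q` is continuous, is a classical solution of `q'' = - μ q / |q| ^ 3` away from `t = 0`
(with one-sided derivatives at `± T`), collides with the center at `t = 0` and only there, and
stays on the closed negative real axis. -/
structure IsCollisionKepler (μ T : ℝ) (q : ℝ → ℂ) : Prop where
  continuousOn : ContinuousOn q (Set.Icc (-T) T)
  newton : ∃ v : ℝ → ℂ, ∀ t ∈ Set.Icc (-T) T, t ≠ 0 →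
    HasDerivWithinAt q (v t) (Set.Icc (-T) T) t ∧
    HasDerivWithinAt v (-((μ / ‖q t‖ ^ 3 : ℝ) : ℂ) * q t) (Set.Icc (-T) T) t
  collision : q 0 = 0
  ne_zero : ∀ t ∈ Set.Icc (-T) T, t ≠ 0 → q t ≠ 0
  mem_negReal : ∀ t ∈ Set.Icc (-T) T, (q t).im = 0 ∧ (q t).re ≤ 0

/-- The closed upper half plane `{x + i y | y ≥ 0}`. -/
def closedUpperHalfPlane : Set ℂ := {w | 0 ≤ w.im}

/-- Membership in the Sobolev space `H¹([a, b], ℂ)` for `a ≤ b`, each class being given by its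
continuous representative: absolutely continuous with square integrable derivative. -/
def MemH1 (a b : ℝ) (z : ℝ → ℂ) : Prop :=
  AbsolutelyContinuousOnInterval z a b ∧
    MeasureTheory.MemLp (deriv z) 2 (MeasureTheory.volume.restrict (Set.Icc a b))

/-- The path space: `H¹` paths on `[a, b]` that start in `A` and end in `B`. -/
def pathSpace (a b : ℝ) (A B : Set ℂ) : Set (ℝ → ℂ) :=
  {z | MemH1 a b z ∧ z a ∈ A ∧ z b ∈ B}

/-- The potential `U(w, t) = μ / |w| + m / |w - q t|` with values in `[0, ∞]`; for positive masses
it is `∞` exactly at the collisions. -/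
noncomputable def potential (μ m : ℝ) (q : ℝ → ℂ) (w : ℂ) (t : ℝ) : ENNReal :=
  ENNReal.ofReal μ / ‖w‖ₑ + ENNReal.ofReal m / ‖w - q t‖ₑ

/-- The action `∫ₐᵇ (1/2) |z'|² + U(z, t) dt` with values in `[0, ∞]`; the integrand is
nonnegative, so the integral always makes sense. -/
noncomputable def action (μ m : ℝ) (q : ℝ → ℂ) (a b : ℝ) (z : ℝ → ℂ) : ENNReal :=
  ∫⁻ t in Set.Icc a b, (‖deriv z t‖ₑ ^ 2 / 2 + potential μ m q (z t) t)

/-- `z` minimizes the action among the paths on `[a, b]` from `A` to `B`. -/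
def IsActionMinimizer (μ m : ℝ) (q : ℝ → ℂ) (a b : ℝ) (A B : Set ℂ) (z : ℝ → ℂ) : Prop :=
  z ∈ pathSpace a b A B ∧ ∀ w ∈ pathSpace a b A B, action μ m q a b z ≤ action μ m q a b w

/-- The ratio `a(t) = |z(t)| / |q(t)|`. -/
noncomputable def ratio (z q : ℝ → ℂ) (t : ℝ) : ℝ := ‖z t‖ / ‖q t‖

end OneCenterTwoBody

/-! Near the collision |q| is comparable to |t|^(2/3), so the claim is that |z| has exactly this
order: with t = -x³, |z(-x³)| ≍ x².

Upper bound. From any point P the collision is reached in time τ along the straight path plus a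
bump, with exponent 2/3 at both ends, in a unit direction v orthogonal to P with Re v ≥ 0.
Orthogonality kills the cross term of the kinetic energy. Since q lies on the negative axis, the
bump bounds the distance to both attracting bodies from below. The action is thus at most |P|²/(2τ)
+ O(τ^(1/3)) (`exists_path_to_collision`). Comparison with the kinetic energy of z on [-2τ, -τ] and
[-τ, 0] puts z(-τ) within O(τ^(2/3)) of z(-2τ)/2 (`IsActionMinimizer.norm_halving`). As 1/2 <
2^(-2/3), iteration gives |z| = O(|t|^(2/3)), hence action O(|t|^(1/3)).

Lower bound. If |z(-x³)| is tiny compared with ρ = y²x², then z enters the disc of radius ρ and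
leaves it again. In units of √(μρ) this costs almost 4√2 ≈ 5.66, while at most half a turn on the
circle in time 3θ/2, θ = ρ^(3/2)/√μ, costs at most π²/3 + 3/2 ≈ 4.79 apart from the attraction of q.
A longer excursion is replaced by an arc of the same duration: both sides then contain (b - a)μ/ρ,
and 8√2/3 ≈ 3.77 beats π²/3 ≈ 3.29. For a shorter one, the missing time is gained by running faster
through the preceding stretch of z, where the approach of q keeps the potential from increasing
(`exists_time_compression`). The speed-up and the attraction of q cost only O(y)√(μρ), so a small y
contradicts minimality (`IsActionMinimizer.lt_norm`). -/

open Set MeasureTheory Filter Topology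

namespace OneCenterTwoBody

/-! ### Reparametrization and gluing of absolutely continuous paths -/

section AbsolutelyContinuous

variable {X : Type*} [PseudoMetricSpace X]

open AbsolutelyContinuousOnInterval in
theorem absolutelyContinuousOnInterval_of_dist_le {Y : Type*} [PseudoMetricSpace Y]
    {f : ℝ → X} {g : ℝ → Y} {a b K : ℝ}
    (hg : AbsolutelyContinuousOnInterval g a b)
    (h : ∀ x ∈ uIcc a b, ∀ y ∈ uIcc a b, dist (f x) (f y) ≤ K * dist (g x) (g y)) :
    AbsolutelyContinuousOnInterval f a b := by
  unfold AbsolutelyContinuousOnInterval at hg ⊢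
  refine squeeze_zero' (Eventually.of_forall fun _ => Finset.sum_nonneg fun _ _ => dist_nonneg)
    ?_ (by simpa using hg.const_mul K)
  rw [eventually_inf_principal]
  filter_upwards with E hE
  rw [Finset.mul_sum]
  exact Finset.sum_le_sum fun i hi => h _ (hE.1 i hi).1 _ (hE.1 i hi).2

open AbsolutelyContinuousOnInterval in
/-- Precomposition with a monotone Lipschitz map preserves absolute continuity. -/
theorem AbsolutelyContinuousOnInterval.comp_monotone {f : ℝ → X} {σ : ℝ → ℝ} {a b c d K : ℝ}
    (hf : AbsolutelyContinuousOnInterval f c d) (hσ : Monotone σ) (hK : 0 ≤ K)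
    (hlip : ∀ x y, dist (σ x) (σ y) ≤ K * dist x y)
    (hmaps : ∀ x ∈ uIcc a b, σ x ∈ uIcc c d) :
    AbsolutelyContinuousOnInterval (f ∘ σ) a b := by
  rw [absolutelyContinuousOnInterval_iff] at hf ⊢
  intro ε hε
  obtain ⟨δ, hδ, H⟩ := hf ε hε
  refine ⟨δ / (K + 1), by positivity, fun E hE hlen => ?_⟩
  refine H (E.1, fun i => (σ (E.2 i).1, σ (E.2 i).2)) ⟨fun i hi =>
    ⟨hmaps _ (hE.1 i hi).1, hmaps _ (hE.1 i hi).2⟩, ?_⟩ ?_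
  · intro i hi j hj hij
    have key := hE.2 hi hj hij
    simp only [Function.onFun] at key ⊢
    have min_map : ∀ x y, min (σ x) (σ y) = σ (min x y) := fun x y => (hσ.map_min).symm
    have max_map : ∀ x y, max (σ x) (σ y) = σ (max x y) := fun x y => (hσ.map_max).symm
    rw [Set.uIoc, Set.uIoc, min_map, max_map, min_map, max_map]
    rw [Set.uIoc, Set.uIoc] at key
    rw [Set.Ioc_disjoint_Ioc] at key ⊢
    rw [min_map, max_map]
    exact hσ key
  · have hK1 : 0 < K + 1 := by linarith
    calc ∑ i ∈ Finset.range E.1, dist (σ (E.2 i).1) (σ (E.2 i).2)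
        ≤ ∑ i ∈ Finset.range E.1, (K + 1) * dist (E.2 i).1 (E.2 i).2 :=
          Finset.sum_le_sum fun i _ => (hlip _ _).trans
            (mul_le_mul_of_nonneg_right (by linarith) dist_nonneg)
      _ = (K + 1) * ∑ i ∈ Finset.range E.1, dist (E.2 i).1 (E.2 i).2 := by
          rw [Finset.mul_sum]
      _ < (K + 1) * (δ / (K + 1)) := by gcongr
      _ = δ := by field_simp

theorem AbsolutelyContinuousOnInterval.congr {f g : ℝ → X} {a b : ℝ}
    (hf : AbsolutelyContinuousOnInterval f a b) (h : EqOn f g (uIcc a b)) :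
    AbsolutelyContinuousOnInterval g a b :=
  absolutelyContinuousOnInterval_of_dist_le (K := 1) hf fun x hx y hy => by
    rw [h hx, h hy, one_mul]

/-- The glued path is f(min t b) + g(max t b) - f b, and both clamps are monotone and 1-Lipschitz.
-/
theorem AbsolutelyContinuousOnInterval.glue {F : Type*} [NormedAddCommGroup F]
    {f g : ℝ → F} {a b c : ℝ} (hab : a ≤ b) (hbc : b ≤ c)
    (hf : AbsolutelyContinuousOnInterval f a b) (hg : AbsolutelyContinuousOnInterval g b c)
    (h : f b = g b) :
    AbsolutelyContinuousOnInterval (fun t => if t ≤ b then f t else g t) a c := by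
  have lip_min : ∀ x y, dist (min x b) (min y b) ≤ 1 * dist x y := fun x y => by
    simpa [Real.dist_eq] using abs_min_sub_min_le_max x b y b
  have lip_max : ∀ x y, dist (max x b) (max y b) ≤ 1 * dist x y := fun x y => by
    simpa [Real.dist_eq] using abs_max_sub_max_le_max x b y b
  have h1 : AbsolutelyContinuousOnInterval (f ∘ fun t => min t b) a c := by
    refine AbsolutelyContinuousOnInterval.comp_monotone hf (K := 1)
      (fun x y hxy => min_le_min_right _ hxy) zero_le_one lip_min fun x hx => ?_
    rw [uIcc_of_le (hab.trans hbc)] at hx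
    rw [uIcc_of_le hab]
    exact ⟨le_min hx.1 hab, min_le_right _ _⟩
  have h2 : AbsolutelyContinuousOnInterval (g ∘ fun t => max t b) a c := by
    refine AbsolutelyContinuousOnInterval.comp_monotone hg (K := 1)
      (fun x y hxy => max_le_max_right _ hxy) zero_le_one lip_max fun x hx => ?_
    rw [uIcc_of_le (hab.trans hbc)] at hx
    rw [uIcc_of_le hbc]
    exact ⟨le_max_right _ _, max_le hx.2 hbc⟩
  have h3 : AbsolutelyContinuousOnInterval (fun _ : ℝ => f b) a c :=
    (LipschitzWith.const (f b)).lipschitzOnWith.absolutelyContinuousOnInterval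
  refine AbsolutelyContinuousOnInterval.congr ((h1.add h2).sub h3) fun t _ => ?_
  by_cases ht : t ≤ b
  · simp [ht, h]
  · simp [ht, (not_le.mp ht).le]

end AbsolutelyContinuous

/-! ### H¹ paths and the action: locality, gluing, minimality on subintervals -/

theorem memH1_iff {a b : ℝ} {z : ℝ → ℂ} : MemH1 a b z ↔
    AbsolutelyContinuousOnInterval z a b ∧ ∫⁻ t in Icc a b, ‖deriv z t‖ₑ ^ 2 < ⊤ := by
  unfold MemH1
  refine and_congr_right fun _ => ?_
  rw [MemLp, eLpNorm_lt_top_iff_lintegral_rpow_enorm_lt_top (by norm_num) (by norm_num)]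
  simp only [(measurable_deriv z).aestronglyMeasurable, true_and]
  norm_num

theorem MemH1.mono {a b c d : ℝ} {z : ℝ → ℂ} (h : MemH1 a b z) (hac : a ≤ c) (hcd : c ≤ d)
    (hdb : d ≤ b) : MemH1 c d z := by
  refine ⟨h.1.mono ?_, h.2.mono_measure (Measure.restrict_mono (Icc_subset_Icc hac hdb) le_rfl)⟩
  rw [uIcc_of_le hcd, uIcc_of_le (by linarith)]
  exact Icc_subset_Icc hac hdb

/-- `deriv` is two-sided, so the endpoints may fail; they are a null set. -/
theorem ae_deriv_eq_of_eqOn {a b : ℝ} {f g : ℝ → ℂ} (h : EqOn f g (Icc a b)) :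
    ∀ᵐ t ∂volume.restrict (Icc a b), deriv f t = deriv g t := by
  rw [← restrict_Ioo_eq_restrict_Icc]
  refine (ae_restrict_iff' measurableSet_Ioo).2 (Eventually.of_forall fun t ht => ?_)
  exact ((h.mono Ioo_subset_Icc_self).eventuallyEq_of_mem (isOpen_Ioo.mem_nhds ht)).deriv_eq

theorem MemH1.congr {a b : ℝ} {f g : ℝ → ℂ} (hab : a ≤ b) (hf : MemH1 a b f)
    (h : EqOn f g (Icc a b)) : MemH1 a b g :=
  ⟨AbsolutelyContinuousOnInterval.congr hf.1 (by rwa [uIcc_of_le hab]),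
    (memLp_congr_ae (ae_deriv_eq_of_eqOn h)).1 hf.2⟩

theorem action_congr {μ m : ℝ} {q : ℝ → ℂ} {a b : ℝ} {f g : ℝ → ℂ} (h : EqOn f g (Icc a b)) :
    action μ m q a b f = action μ m q a b g := by
  refine lintegral_congr_ae ?_
  filter_upwards [ae_deriv_eq_of_eqOn h, ae_restrict_mem measurableSet_Icc] with t ht hm
  rw [ht, h hm]

theorem setLIntegral_Icc_add {f : ℝ → ENNReal} {a b c : ℝ} (hab : a ≤ b) (hbc : b ≤ c) :
    ∫⁻ t in Icc a c, f t = (∫⁻ t in Icc a b, f t) + ∫⁻ t in Icc b c, f t := by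
  rw [← Icc_union_Ioc_eq_Icc hab hbc, lintegral_union measurableSet_Ioc,
    restrict_Ioc_eq_restrict_Icc]
  exact (Set.disjoint_left.2 fun x hx hx' => not_lt.2 hx.2 hx'.1)

theorem action_add {μ m : ℝ} {q : ℝ → ℂ} {a b c : ℝ} {z : ℝ → ℂ} (hab : a ≤ b) (hbc : b ≤ c) :
    action μ m q a c z = action μ m q a b z + action μ m q b c z :=
  setLIntegral_Icc_add hab hbc

theorem action_mono {μ m : ℝ} {q : ℝ → ℂ} {a b c d : ℝ} {z : ℝ → ℂ} (hac : a ≤ c) (hdb : d ≤ b) :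
    action μ m q c d z ≤ action μ m q a b z :=
  lintegral_mono_set (Icc_subset_Icc hac hdb)

section Glue

variable {a b c : ℝ} {f g : ℝ → ℂ}

theorem glue_eqOn_left : EqOn f (fun t => if t ≤ b then f t else g t) (Icc a b) :=
  fun t ht => by simp [ht.2]

theorem glue_eqOn_right (h : f b = g b) :
    EqOn g (fun t => if t ≤ b then f t else g t) (Icc b c) := fun t ht => by
  rcases ht.1.eq_or_lt with rfl | h'
  · simp [h]
  · simp [h']

theorem MemH1.glue (hab : a ≤ b) (hbc : b ≤ c) (hf : MemH1 a b f) (hg : MemH1 b c g)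
    (h : f b = g b) : MemH1 a c (fun t => if t ≤ b then f t else g t) := by
  have hf' := memH1_iff.1 (hf.congr hab (glue_eqOn_left (g := g)))
  have hg' := memH1_iff.1 (hg.congr hbc (glue_eqOn_right h))
  refine memH1_iff.2 ⟨AbsolutelyContinuousOnInterval.glue hab hbc hf.1 hg.1 h, ?_⟩
  rw [setLIntegral_Icc_add hab hbc]
  exact ENNReal.add_lt_top.2 ⟨hf'.2, hg'.2⟩

theorem action_glue {μ m : ℝ} {q : ℝ → ℂ} (hab : a ≤ b) (hbc : b ≤ c) (h : f b = g b) :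
    action μ m q a c (fun t => if t ≤ b then f t else g t) =
      action μ m q a b f + action μ m q b c g := by
  rw [action_add hab hbc, ← action_congr glue_eqOn_left, ← action_congr (glue_eqOn_right h)]

end Glue

/-- A minimizer of finite action minimizes on each subinterval among the paths with the same ends. -/
theorem IsActionMinimizer.action_le {μ m : ℝ} {q : ℝ → ℂ} {α β : ℝ} {A B : Set ℂ} {z : ℝ → ℂ}
    (hz : IsActionMinimizer μ m q α β A B z) (hfin : action μ m q α β z ≠ ⊤) {a b : ℝ}
    (ha : α ≤ a) (hab : a ≤ b) (hb : b ≤ β) {w : ℝ → ℂ} (hw : MemH1 a b w)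
    (hwa : w a = z a) (hwb : w b = z b) : action μ m q a b z ≤ action μ m q a b w := by
  have hz1 := hz.1.1
  have hg : MemH1 a β (fun t => if t ≤ b then w t else z t) :=
    hw.glue hab hb (hz1.mono (ha.trans hab) hb le_rfl) hwb
  have hga : z a = (fun t => if t ≤ b then w t else z t) a := by simp [hab, hwa]
  have hG := (hz1.mono le_rfl ha (hab.trans hb)).glue ha (hab.trans hb) hg hga
  have hmin := hz.2 _ ⟨hG, by simpa [ha] using hz.1.2.1, ?_⟩
  · rw [action_glue ha (hab.trans hb) hga, action_glue hab hb hwb,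
      action_add ha (hab.trans hb), action_add hab hb] at hmin
    rw [action_add ha (hab.trans hb), action_add hab hb] at hfin
    simp only [ne_eq, ENNReal.add_eq_top, not_or] at hfin
    rw [ENNReal.add_le_add_iff_left hfin.1] at hmin
    exact (ENNReal.add_le_add_iff_right hfin.2.2).1 hmin
  · have := glue_eqOn_right (c := β) hwb ⟨hb, le_rfl⟩
    have h2 := glue_eqOn_right (c := β) (f := z)
      (g := fun t => if t ≤ b then w t else z t) hga ⟨hab.trans hb, le_rfl⟩
    simp only at this h2
    rw [← h2, ← this]
    exact hz.1.2.2

/-! ### Lower bounds for the action from increments -/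

/-- Increments of `Φ (|z - p|)` are controlled by the kinetic energy and `Φ' ^ 2`. -/
theorem ofReal_abs_sub_le_lintegral {a b : ℝ} (hab : a ≤ b) {z : ℝ → ℂ}
    (hz : AbsolutelyContinuousOnInterval z a b) (p : ℂ) {Φ Φ' : ℝ → ℝ}
    (hΦ : ∀ r, 0 ≤ r → HasDerivAt Φ (Φ' r) r) (hΦ' : ContinuousOn Φ' (Ici 0)) :
    ENNReal.ofReal |Φ ‖z b - p‖ - Φ ‖z a - p‖| ≤
      ∫⁻ t in Icc a b, (‖deriv z t‖ₑ ^ 2 / 2 + ENNReal.ofReal (Φ' ‖z t - p‖ ^ 2 / 2)) := by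
  set r : ℝ → ℝ := fun t => ‖z t - p‖ with hr
  have hr0 : ∀ t, 0 ≤ r t := fun t => norm_nonneg _
  have hdist : ∀ x y, dist (r x) (r y) ≤ 1 * dist (z x) (z y) := fun x y => by
    rw [one_mul, Real.dist_eq, dist_eq_norm]
    simpa [hr] using abs_norm_sub_norm_le (z x - p) (z y - p)
  have hrac : AbsolutelyContinuousOnInterval r a b :=
    absolutelyContinuousOnInterval_of_dist_le hz fun x _ y _ => hdist x y
  obtain ⟨M, hM⟩ := hrac.exists_bound
  obtain ⟨K, hK⟩ := isCompact_Icc.exists_bound_of_continuousOn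
    (hΦ'.mono (Icc_subset_Ici_self : Icc 0 M ⊆ Ici 0))
  have hlip : LipschitzOnWith K.toNNReal Φ (Icc 0 M) :=
    Convex.lipschitzOnWith_of_nnnorm_hasDerivWithin_le (convex_Icc 0 M)
      (fun x hx => (hΦ x hx.1).hasDerivWithinAt) fun x hx => by
        rw [← NNReal.coe_le_coe, coe_nnnorm]
        exact (hK x hx).trans (Real.le_coe_toNNReal K)
  have hrM : ∀ x ∈ uIcc a b, r x ∈ Icc 0 M := fun x hx =>
    ⟨hr0 x, (le_abs_self _).trans (hM x hx)⟩
  have hfac : AbsolutelyContinuousOnInterval (fun t => Φ (r t)) a b :=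
    absolutelyContinuousOnInterval_of_dist_le hrac fun x hx y hy =>
      hlip.dist_le_mul _ (hrM x hx) _ (hrM y hy)
  have hint := hfac.integral_deriv_eq_sub
  have hsub : Icc a b ⊆ uIcc a b := by rw [uIcc_of_le hab]
  calc ENNReal.ofReal |Φ (r b) - Φ (r a)|
      = ‖∫ t in a..b, deriv (fun t => Φ (r t)) t‖ₑ := by
        rw [hint, ← ofReal_norm, Real.norm_eq_abs]
    _ ≤ ∫⁻ t in Icc a b, ‖deriv (fun t => Φ (r t)) t‖ₑ := by
        rw [intervalIntegral.integral_of_le hab, ← restrict_Ioc_eq_restrict_Icc]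
        exact enorm_integral_le_lintegral_enorm _
    _ ≤ _ := by
        refine lintegral_mono_ae ?_
        filter_upwards [ae_restrict_of_ae hrac.ae_differentiableAt,
          ae_restrict_of_ae hz.boundedVariationOn.ae_differentiableAt_of_mem_uIcc,
          ae_restrict_mem measurableSet_Icc] with t hrd hzd ht
        have hrd := (hrd (hsub ht)).hasDerivAt
        have hzd := (hzd (hsub ht)).hasDerivAt
        have hle : ‖deriv r t‖ ≤ ‖deriv z t‖ := by
          have h1 := hrd.tendsto_slope.norm
          have h2 := hzd.tendsto_slope.norm
          refine le_of_tendsto_of_tendsto' h1 h2 fun y => ?_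
          rw [slope_def_module, slope_def_module, norm_smul, norm_smul]
          gcongr
          simpa [dist_eq_norm, Real.norm_eq_abs] using hdist y t
        have hd : HasDerivAt (fun t => Φ (r t)) (Φ' (r t) * deriv r t) t :=
          (hΦ (r t) (hr0 t)).comp t hrd
        rw [hd.deriv, ← ofReal_norm, ← ofReal_norm, norm_mul,
          ← ENNReal.ofReal_pow (norm_nonneg _),
          show (2 : ENNReal) = ENNReal.ofReal 2 by simp,
          ← ENNReal.ofReal_div_of_pos two_pos, ← ENNReal.ofReal_add (by positivity) (by positivity)]
        refine ENNReal.ofReal_le_ofReal ?_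
        have hΦn : Φ' (r t) ^ 2 = ‖Φ' (r t)‖ ^ 2 := by simp
        change _ ≤ ‖deriv z t‖ ^ 2 / 2 + Φ' (r t) ^ 2 / 2
        rw [hΦn]
        nlinarith [sq_nonneg (‖Φ' (r t)‖ - ‖deriv z t‖), norm_nonneg (Φ' (r t)),
          norm_nonneg (deriv z t), mul_le_mul_of_nonneg_left hle (norm_nonneg (Φ' (r t)))]

/-- Cauchy–Schwarz, obtained from the linear Φ(r) = l r whose slope l is the mean speed. -/
theorem ofReal_sq_norm_sub_le_lintegral {a b : ℝ} (hab : a < b) {z : ℝ → ℂ}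
    (hz : AbsolutelyContinuousOnInterval z a b) :
    ENNReal.ofReal (‖z b - z a‖ ^ 2 / (2 * (b - a))) ≤
      ∫⁻ t in Icc a b, ‖deriv z t‖ₑ ^ 2 / 2 := by
  have hba : 0 < b - a := sub_pos.2 hab
  set l : ℝ := ‖z b - z a‖ / (b - a) with hl
  have hl0 : 0 ≤ l := by positivity
  have key := ofReal_abs_sub_le_lintegral hab.le hz (z a) (Φ := fun r => l * r) (Φ' := fun _ => l)
    (fun r _ => by simpa using (hasDerivAt_id r).const_mul l) continuousOn_const
  rw [lintegral_add_right _ measurable_const] at key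
  simp only [sub_self, norm_zero, mul_zero, sub_zero, lintegral_const,
    MeasurableSet.univ, Measure.restrict_apply, univ_inter, Real.volume_Icc] at key
  rw [← ENNReal.ofReal_mul (by positivity), abs_of_nonneg (by positivity)] at key
  have h2 : ENNReal.ofReal (‖z b - z a‖ ^ 2 / (2 * (b - a))) + ENNReal.ofReal (l ^ 2 / 2 * (b - a))
      = ENNReal.ofReal (l * ‖z b - z a‖) := by
    rw [← ENNReal.ofReal_add (by positivity) (by positivity)]
    congr 1
    rw [hl]; field_simp; ring
  rw [← h2] at key
  exact (ENNReal.add_le_add_iff_right ENNReal.ofReal_ne_top).1 key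

/-! ### Asymptotics of the Kepler collision -/

section Kepler

variable {μ T : ℝ} {q : ℝ → ℂ}

theorem IsCollisionKepler.re_eq_neg_norm (hq : IsCollisionKepler μ T q) {t : ℝ}
    (ht : t ∈ Icc (-T) T) : (q t).re = -‖q t‖ := by
  obtain ⟨h1, h2⟩ := hq.mem_negReal t ht
  rw [← Complex.abs_re_eq_norm.2 h1, abs_of_nonpos h2, neg_neg]

/-- The distance `s = |q|` satisfies `s'' = - μ / s ^ 2` before the collision. -/
theorem IsCollisionKepler.exists_radial_velocity (hq : IsCollisionKepler μ T q) :
    ∃ w : ℝ → ℝ, ∀ t ∈ Ioo (-T) 0, HasDerivAt (fun t => ‖q t‖) (w t) t ∧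
      HasDerivAt w (-(μ / ‖q t‖ ^ 2)) t := by
  obtain ⟨v, hv⟩ := hq.newton
  refine ⟨fun t => -(v t).re, fun t ht => ?_⟩
  have htT : t ∈ Icc (-T) T := ⟨ht.1.le, by linarith [ht.1, ht.2]⟩
  have hnhds : Icc (-T) T ∈ 𝓝 t := Icc_mem_nhds ht.1 (by linarith [ht.1, ht.2])
  obtain ⟨h1, h2⟩ := hv t htT ht.2.ne
  have h1' := h1.hasDerivAt hnhds
  have h2' := h2.hasDerivAt hnhds
  have hs : 0 < ‖q t‖ := norm_pos_iff.2 (hq.ne_zero t htT ht.2.ne)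
  constructor
  · have h3 : HasDerivAt (fun t => -(q t).re) (-(v t).re) t :=
      (Complex.reCLM.hasFDerivAt.comp_hasDerivAt t h1').neg
    refine h3.congr_of_eventuallyEq ?_
    filter_upwards [hnhds] with x hx
    rw [hq.re_eq_neg_norm hx, neg_neg]
  · have h3 := (Complex.reCLM.hasFDerivAt.comp_hasDerivAt t h2').neg
    refine h3.congr_deriv ?_
    simp only [Complex.reCLM_apply, neg_mul, Complex.neg_re, Complex.re_ofReal_mul, neg_neg]
    rw [hq.re_eq_neg_norm htT]
    field_simp

/-- Asymptotics of a collision: `|q|` is comparable to `|t| ^ (2 / 3)`, and decreasing. -/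
theorem IsCollisionKepler.exists_bounds (hμ : 0 < μ) (hT : 0 < T) (hq : IsCollisionKepler μ T q) :
    ∃ ε, 0 < ε ∧ ε < T ∧
      (∀ t ∈ Ico (-ε) 0, 9 / 4 * μ * t ^ 2 ≤ ‖q t‖ ^ 3 ∧ ‖q t‖ ^ 3 ≤ 9 * μ * t ^ 2) ∧
      AntitoneOn (fun t => ‖q t‖) (Icc (-ε) 0) := by
  obtain ⟨w, hw⟩ := hq.exists_radial_velocity
  have hpos : ∀ t ∈ Ioo (-T) 0, 0 < ‖q t‖ := fun t ht =>
    norm_pos_iff.2 (hq.ne_zero t ⟨ht.1.le, by linarith [ht.2]⟩ ht.2.ne)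
  have hcont : ContinuousOn (fun t => ‖q t‖) (Icc (-T) T) := hq.continuousOn.norm
  -- Conservation of energy.
  obtain ⟨h, hh⟩ : ∃ h, ∀ t ∈ Ioo (-T) 0, w t ^ 2 / 2 - μ / ‖q t‖ = h := by
    have hd : ∀ t ∈ Ioo (-T) 0, HasDerivAt (fun t => w t ^ 2 / 2 - μ / ‖q t‖) 0 t := by
      intro t ht
      have hs := hpos t ht
      have h1 := (((hw t ht).2.pow 2).div_const 2).sub
        ((hasDerivAt_const t μ).div (hw t ht).1 hs.ne')
      refine h1.congr_deriv ?_
      simp; field_simp; ring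
    exact isOpen_Ioo.exists_is_const_of_deriv_eq_zero isPreconnected_Ioo
      (fun t ht => (hd t ht).differentiableAt.differentiableWithinAt) fun t ht => (hd t ht).deriv
  have hmvt : ∀ t ∈ Ioo (-T) 0, ∃ c ∈ Ioo t 0, w c < 0 := by
    intro t ht
    obtain ⟨c, hc, hc'⟩ := exists_hasDerivAt_eq_slope (fun t => ‖q t‖) w ht.2
      (hcont.mono (Icc_subset_Icc ht.1.le hT.le)) fun x hx => (hw x ⟨ht.1.trans hx.1, hx.2⟩).1
    refine ⟨c, hc, ?_⟩
    rw [hc']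
    simp only [hq.collision, norm_zero]
    exact div_neg_of_neg_of_pos (by linarith [hpos t ht]) (by linarith [ht.2])
  have hwanti : AntitoneOn w (Ioo (-T) 0) := by
    refine antitoneOn_of_hasDerivWithinAt_nonpos (convex_Ioo _ _)
      (fun t ht => (hw t ht).2.continuousAt.continuousWithinAt)
      (fun t ht => (hw t (interior_subset ht)).2.hasDerivWithinAt) fun t ht => ?_
    have := hpos t (interior_subset ht)
    exact neg_nonpos.2 (by positivity)
  have hev : ∀ᶠ t in 𝓝[Icc (-T) T] 0, ‖q t‖ < μ / (2 * |h| + 1) := by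
    have := hcont 0 ⟨by linarith, hT.le⟩
    refine this.eventually_lt_const ?_
    simp only [hq.collision, norm_zero]
    positivity
  obtain ⟨ε₀, hε₀, hsmall⟩ := Metric.eventually_nhds_iff.1 (eventually_nhdsWithin_iff.1 hev)
  -- The velocity is negative at some time c close to the collision; since it is nonincreasing, it
  -- stays negative from c on.
  obtain ⟨c, hc, hwc⟩ := hmvt (max (-ε₀) (-T) / 2) (by
    rcases max_cases (-ε₀) (-T) with h | h <;> constructor <;> linarith)
  have hcε : -ε₀ < c := by linarith [hc.1, le_max_left (-ε₀) (-T), hc.2]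
  have hcT : -T < c := by linarith [hc.1, le_max_right (-ε₀) (-T), hc.2]
  have hmem : ∀ t ∈ Ico c 0, t ∈ Ioo (-T) 0 := fun t ht => ⟨hcT.trans_le ht.1, ht.2⟩
  have hwneg : ∀ t ∈ Ico c 0, w t < 0 := fun t ht =>
    (hwanti ⟨hcT, hc.2⟩ (hmem t ht) ht.1).trans_lt hwc
  -- With s = |q|, energy conservation reads s w² = 2μ + 2hs, and s(2|h| + 1) < μ makes the last
  -- term smaller than μ.
  have hwsq : ∀ t ∈ Ico c 0, μ ≤ ‖q t‖ * w t ^ 2 ∧ ‖q t‖ * w t ^ 2 ≤ 4 * μ := by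
    intro t ht
    have hs := hpos t (hmem t ht)
    have h1 := hh t (hmem t ht)
    have h2 : ‖q t‖ < μ / (2 * |h| + 1) := by
      refine hsmall ?_ ⟨(hmem t ht).1.le, by linarith [ht.2]⟩
      rw [Real.dist_eq, sub_zero, abs_of_neg ht.2]
      linarith [ht.1]
    rw [lt_div_iff₀ (by positivity)] at h2
    have h3 : ‖q t‖ * w t ^ 2 = 2 * μ + 2 * (‖q t‖ * h) := by
      rw [← h1]; field_simp; ring
    have h4 : |‖q t‖ * h| = ‖q t‖ * |h| := by rw [abs_mul, abs_of_pos hs]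
    have h5 := abs_le.1 h4.le
    rw [h3]
    constructor <;> nlinarith [h5.1, h5.2]
  have hcont' : ∀ t, c ≤ t → ContinuousOn (fun t => ‖q t‖) (Icc t 0) := fun t ht =>
    hcont.mono (Icc_subset_Icc (hcT.le.trans ht) hT.le)
  refine ⟨-c, by linarith [hc.2], by linarith, fun t ht => ?_, ?_⟩
  · rw [neg_neg] at ht
    -- The mean value theorem for s^(3/2): its derivative (3/2)√s w has square (9/4) s w², which was
    -- just bounded on both sides.
    obtain ⟨x, hx, hx'⟩ := exists_hasDerivAt_eq_slope (fun t => ‖q t‖ * √‖q t‖)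
      (fun t => 3 / 2 * √‖q t‖ * w t) ht.2
      ((hcont' t ht.1).mul (hcont' t ht.1).sqrt) fun x hx => by
        have hxm := hmem x ⟨ht.1.trans hx.1.le, hx.2⟩
        have hs := hpos x hxm
        refine ((hw x hxm).1.mul ((hw x hxm).1.sqrt hs.ne')).congr_deriv ?_
        have := Real.sqrt_pos.2 hs
        have h2 := Real.mul_self_sqrt hs.le
        field_simp
        linear_combination (-w x) * h2
    have hxm : x ∈ Ico c 0 := ⟨ht.1.trans hx.1.le, hx.2⟩
    simp only [hq.collision, norm_zero, zero_mul, zero_sub] at hx'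
    have h1 : ‖q t‖ * √‖q t‖ = 3 / 2 * √‖q x‖ * w x * t := by
      rw [hx']; have := ht.2.ne; field_simp
    have h2 : ‖q t‖ ^ 3 = 9 / 4 * (‖q x‖ * w x ^ 2) * t ^ 2 := by
      calc ‖q t‖ ^ 3 = (‖q t‖ * √‖q t‖) ^ 2 := by
            rw [mul_pow, Real.sq_sqrt (norm_nonneg _)]; ring
        _ = _ := by rw [h1, mul_pow, mul_pow, mul_pow, Real.sq_sqrt (norm_nonneg _)]; ring
    obtain ⟨h3, h4⟩ := hwsq x hxm
    rw [h2]
    constructor <;> nlinarith [sq_nonneg t]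
  · rw [neg_neg]
    refine antitoneOn_of_hasDerivWithinAt_nonpos (f' := w) (convex_Icc _ _) (hcont' c le_rfl)
      (fun t ht => ?_) (fun t ht => ?_) <;> rw [interior_Icc] at ht
    · exact (hw t (hmem t ⟨ht.1.le, ht.2⟩)).1.hasDerivWithinAt
    · exact (hwneg t ⟨ht.1.le, ht.2⟩).le

end Kepler

/-! ### Cheap paths into the total collision -/

theorem absolutelyContinuousOnInterval_of_hasDerivAt {f f' : ℝ → ℝ} {a b : ℝ} (hab : a ≤ b)
    (hf : ContinuousOn f (Icc a b)) (hf' : ∀ t ∈ Ioo a b, HasDerivAt f (f' t) t)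
    (hint : IntervalIntegrable f' volume a b) : AbsolutelyContinuousOnInterval f a b := by
  have h1 := (hint.absolutelyContinuousOnInterval_intervalIntegral (c := a) (by simp)).add
    (LipschitzWith.const (f a)).lipschitzOnWith.absolutelyContinuousOnInterval
  refine AbsolutelyContinuousOnInterval.congr h1 fun x hx => ?_
  rw [uIcc_of_le hab] at hx
  have := intervalIntegral.integral_eq_sub_of_hasDerivAt_of_le hx.1
    (hf.mono (Icc_subset_Icc_right hx.2)) (fun t ht => hf' t ⟨ht.1, ht.2.trans_le hx.2⟩)
    (hint.mono_set (by rw [uIcc_of_le hx.1, uIcc_of_le hab]; exact Icc_subset_Icc_right hx.2))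
  simp [this]

theorem ofReal_div_enorm_le {k r : ℝ} {w : ℂ} (hr : 0 < r) (h : r ≤ ‖w‖) :
    ENNReal.ofReal k / ‖w‖ₑ ≤ ENNReal.ofReal (k / r) := by
  rw [← ofReal_norm, ENNReal.ofReal_div_of_pos hr]
  exact ENNReal.div_le_div_left (ENNReal.ofReal_le_ofReal h) _

theorem enorm_sq_div_two (w : ℂ) : ‖w‖ₑ ^ 2 / 2 = ENNReal.ofReal (‖w‖ ^ 2 / 2) := by
  rw [← ofReal_norm, ← ENNReal.ofReal_pow (norm_nonneg _), ENNReal.ofReal_div_of_pos two_pos]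
  simp

/-- The weight `(t + τ) ^ (- 2 / 3) + (- t) ^ (- 2 / 3)` on `[- τ, 0]`. -/
noncomputable def endpointWeight (τ t : ℝ) : ℝ := (t + τ) ^ (-(2 / 3) : ℝ) + (-t) ^ (-(2 / 3) : ℝ)

/-- The bump `((t + τ) (- t) / τ) ^ (2 / 3)` on `[- τ, 0]`. -/
noncomputable def collisionBump (τ t : ℝ) : ℝ :=
  (t + τ) ^ (2 / 3 : ℝ) * (-t) ^ (2 / 3 : ℝ) / τ ^ (2 / 3 : ℝ)

theorem intervalIntegrable_endpointWeight (τ : ℝ) :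
    IntervalIntegrable (endpointWeight τ) volume (-τ) 0 := by
  have h : ∀ a b : ℝ, IntervalIntegrable (fun x : ℝ => x ^ (-(2 / 3) : ℝ)) volume a b :=
    fun a b => intervalIntegral.intervalIntegrable_rpow' (by norm_num)
  refine IntervalIntegrable.add ?_ ?_
  · simpa using (h 0 τ).comp_add_right τ
  · simpa using ((h τ 0).comp_sub_left 0)

theorem integral_endpointWeight {τ : ℝ} :
    ∫ t in (-τ)..0, endpointWeight τ t = 6 * τ ^ (1 / 3 : ℝ) := by
  have h : ∀ a b : ℝ, IntervalIntegrable (fun x : ℝ => x ^ (-(2 / 3) : ℝ)) volume a b :=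
    fun a b => intervalIntegral.intervalIntegrable_rpow' (by norm_num)
  have h0 : ∫ x in (0:ℝ)..τ, x ^ (-(2 / 3) : ℝ) = 3 * τ ^ (1 / 3 : ℝ) := by
    rw [integral_rpow (Or.inl (by norm_num))]
    norm_num
    ring
  unfold endpointWeight
  rw [intervalIntegral.integral_add (by simpa using (h 0 τ).comp_add_right τ)
    (by simpa using ((h τ 0).comp_sub_left 0)), intervalIntegral.integral_comp_neg
    (f := fun x : ℝ => x ^ (-(2 / 3) : ℝ)), intervalIntegral.integral_comp_add_right
    (f := fun x : ℝ => x ^ (-(2 / 3) : ℝ))]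
  simp only [neg_add_cancel, zero_add, neg_zero, neg_neg, h0]
  ring

/-- In the cube roots A, B, R of t + τ, -t, τ everything is rational: the bump is A²B²/R², the
weight is 1/A² + 1/B², and A³ + B³ = R³. Hence R ≤ A + B, so R² ≤ 2(A² + B²), which gives both
estimates. -/
theorem collisionBump_estimates {τ t : ℝ} (ht : t ∈ Ioo (-τ) 0) :
    0 < collisionBump τ t ∧ 1 / collisionBump τ t ≤ 2 * endpointWeight τ t ∧
      ∃ d, HasDerivAt (collisionBump τ) d t ∧ d ^ 2 ≤ endpointWeight τ t := by
  have ha : 0 < t + τ := by linarith [ht.1]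
  have hb : 0 < -t := by linarith [ht.2]
  have hτ : 0 < τ := by linarith
  set A := (t + τ) ^ (1 / 3 : ℝ) with hA
  set B := (-t) ^ (1 / 3 : ℝ) with hB
  set R := τ ^ (1 / 3 : ℝ) with hR
  have hA0 : 0 < A := by positivity
  have hB0 : 0 < B := by positivity
  have hR0 : 0 < R := by positivity
  have p3 : ∀ x : ℝ, 0 < x → (x ^ (1 / 3 : ℝ)) ^ 3 = x := fun x hx => by
    rw [← Real.rpow_natCast, ← Real.rpow_mul hx.le]; norm_num
  have p2 : ∀ x : ℝ, 0 < x → x ^ (2 / 3 : ℝ) = (x ^ (1 / 3 : ℝ)) ^ 2 := fun x hx => by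
    rw [← Real.rpow_natCast, ← Real.rpow_mul hx.le]; norm_num
  have pm2 : ∀ x : ℝ, 0 < x → x ^ (-(2 / 3) : ℝ) = 1 / (x ^ (1 / 3 : ℝ)) ^ 2 := fun x hx => by
    rw [Real.rpow_neg hx.le, p2 x hx, one_div ((x ^ (1 / 3 : ℝ)) ^ 2)]
  have pm1 : ∀ x : ℝ, 0 < x → x ^ (2 / 3 - 1 : ℝ) = 1 / (x ^ (1 / 3 : ℝ)) := fun x hx => by
    rw [one_div, ← Real.rpow_neg hx.le]; norm_num
  have hsum : A ^ 3 + B ^ 3 = R ^ 3 := by rw [p3 _ ha, p3 _ hb, p3 _ hτ]; ring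
  have hw : endpointWeight τ t = 1 / A ^ 2 + 1 / B ^ 2 := by
    rw [endpointWeight, pm2 _ ha, pm2 _ hb]
  have hg : collisionBump τ t = A ^ 2 * B ^ 2 / R ^ 2 := by
    rw [collisionBump, p2 _ ha, p2 _ hb, p2 _ hτ]
  have hRAB : R ≤ A + B := by
    by_contra! hlt
    have : (A + B) ^ 3 < R ^ 3 := pow_lt_pow_left₀ hlt (by positivity) (by norm_num)
    nlinarith [mul_pos hA0 hB0, mul_pos (mul_pos hA0 hB0) hA0, mul_pos (mul_pos hA0 hB0) hB0]
  have hR2 : R ^ 2 ≤ 2 * (A ^ 2 + B ^ 2) := by nlinarith [sq_nonneg (A - B)]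
  have hw2 : endpointWeight τ t = (A ^ 2 + B ^ 2) / (A ^ 2 * B ^ 2) := by rw [hw]; field_simp; ring
  refine ⟨by rw [hg]; positivity, ?_, 2 / 3 * (B ^ 3 - A ^ 3) / (A * B * R ^ 2), ?_, ?_⟩
  · rw [hg, hw2, one_div_div, ← mul_div_assoc]
    gcongr
  · have h1 : HasDerivAt (fun t : ℝ => (t + τ) ^ (2 / 3 : ℝ)) (1 * (2 / 3) * (t + τ) ^ (2 / 3 - 1 : ℝ)) t :=
      ((hasDerivAt_id t).add_const τ).rpow_const (Or.inl ha.ne')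
    have h2 : HasDerivAt (fun t : ℝ => (-t) ^ (2 / 3 : ℝ)) (-1 * (2 / 3) * (-t) ^ (2 / 3 - 1 : ℝ)) t :=
      ((hasDerivAt_id t).neg).rpow_const (Or.inl hb.ne')
    refine ((h1.mul h2).div_const (τ ^ (2 / 3 : ℝ))).congr_deriv ?_
    rw [pm1 _ ha, pm1 _ hb, p2 _ ha, p2 _ hb, p2 _ hτ, ← hA, ← hB, ← hR]
    field_simp
    ring
  · rw [hw2, div_pow, div_le_div_iff₀ (by positivity) (by positivity)]
    have h1 : (B ^ 3 - A ^ 3) ^ 2 ≤ (R ^ 3) ^ 2 := by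
      rw [← hsum]; nlinarith [pow_pos hA0 3, pow_pos hB0 3, mul_pos (pow_pos hA0 3) (pow_pos hB0 3)]
    have h2 : (2 / 3 * (B ^ 3 - A ^ 3)) ^ 2 ≤ R ^ 4 * (A ^ 2 + B ^ 2) := by
      nlinarith [pow_pos hR0 4, mul_le_mul_of_nonneg_left hR2 (pow_pos hR0 4).le]
    calc (2 / 3 * (B ^ 3 - A ^ 3)) ^ 2 * (A ^ 2 * B ^ 2)
        ≤ R ^ 4 * (A ^ 2 + B ^ 2) * (A ^ 2 * B ^ 2) := by gcongr
      _ = _ := by ring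

/-- The derivative d blows up at both ends, so the bump is not Lipschitz; but |d| ≤ 1 + d² ≤ 1 +
weight is integrable. -/
theorem collisionBump_absolutelyContinuous {τ : ℝ} (hτ : 0 < τ) :
    AbsolutelyContinuousOnInterval (collisionBump τ) (-τ) 0 := by
  refine absolutelyContinuousOnInterval_of_hasDerivAt (f' := deriv (collisionBump τ)) (by linarith)
    ?_ (fun t ht => ?_) ?_
  · unfold collisionBump
    refine ContinuousOn.div_const (ContinuousOn.mul ?_ ?_) _
    · exact (continuous_id.add continuous_const).continuousOn.rpow_const
        fun t _ => Or.inr (by norm_num)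
    · exact continuous_neg.continuousOn.rpow_const fun t _ => Or.inr (by norm_num)
  · obtain ⟨d, hd, -⟩ := (collisionBump_estimates ht).2.2
    exact hd.differentiableAt.hasDerivAt
  · have h1 : IntervalIntegrable (fun t => 1 + endpointWeight τ t) volume (-τ) 0 :=
      intervalIntegrable_const.add (intervalIntegrable_endpointWeight τ)
    refine h1.mono_fun (measurable_deriv _).aestronglyMeasurable ?_
    rw [uIoc_of_le (by linarith), ← restrict_Ioo_eq_restrict_Ioc]
    refine (ae_restrict_iff' measurableSet_Ioo).2 (Eventually.of_forall fun t ht => ?_)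
    obtain ⟨d, hd, hd2⟩ := (collisionBump_estimates ht).2.2
    simp only [hd.deriv, Real.norm_eq_abs]
    refine le_trans ?_ (le_abs_self _)
    exact abs_le.2 ⟨by nlinarith [sq_nonneg (d + 1)], by nlinarith [sq_nonneg (d - 1)]⟩

/-- A unit vector of the closed right half plane orthogonal to `P`. -/
theorem exists_unit_orthogonal (P : ℂ) :
    ∃ v : ℂ, v.re ^ 2 + v.im ^ 2 = 1 ∧ 0 ≤ v.re ∧ P.re * v.re + P.im * v.im = 0 := by
  by_cases hP : P = 0
  · exact ⟨1, by simp [hP]⟩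
  have hn : 0 < ‖P‖ := norm_pos_iff.2 hP
  have hsq : P.re ^ 2 + P.im ^ 2 = ‖P‖ ^ 2 := by
    rw [← Complex.normSq_eq_norm_sq, Complex.normSq_apply]; ring
  rcases le_total 0 P.im with h | h
  · refine ⟨⟨P.im / ‖P‖, -P.re / ‖P‖⟩, ?_, by positivity, by simp; ring⟩
    simp only; field_simp; linarith
  · refine ⟨⟨-P.im / ‖P‖, P.re / ‖P‖⟩, ?_, div_nonneg (by linarith) hn.le, by simp; ring⟩
    simp only; field_simp; linarith

theorem component_le_norm {v w : ℂ} (hv : v.re ^ 2 + v.im ^ 2 = 1) :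
    w.re * v.re + w.im * v.im ≤ ‖w‖ := by
  have hsq : w.re ^ 2 + w.im ^ 2 = ‖w‖ ^ 2 := by
    rw [← Complex.normSq_eq_norm_sq, Complex.normSq_apply]; ring
  refine le_of_abs_le (abs_le_of_sq_le_sq ?_ (norm_nonneg w))
  rw [← hsq]
  nlinarith [sq_nonneg (w.re * v.im - w.im * v.re)]

/-- From any point one can reach the total collision in time `τ` with action at most that of the
straight path plus `O (τ ^ (1 / 3))`. -/
theorem exists_path_to_collision {μ m τ : ℝ} (hμ : 0 < μ) (hm : 0 < m) (hτ : 0 < τ) {q : ℝ → ℂ}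
    (hq : ∀ t ∈ Icc (-τ) 0, (q t).im = 0 ∧ (q t).re ≤ 0) (P : ℂ) :
    ∃ w, MemH1 (-τ) 0 w ∧ w (-τ) = P ∧ w 0 = 0 ∧ action μ m q (-τ) 0 w ≤
      ENNReal.ofReal (‖P‖ ^ 2 / (2 * τ) + (3 + 12 * (μ + m)) * τ ^ (1 / 3 : ℝ)) := by
  obtain ⟨v, hv1, hv0, hPv⟩ := exists_unit_orthogonal P
  have hPsq : P.re ^ 2 + P.im ^ 2 = ‖P‖ ^ 2 := by
    rw [← Complex.normSq_eq_norm_sq, Complex.normSq_apply]; ring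
  set w : ℝ → ℂ := fun t => (-t / τ) • P + collisionBump τ t • v with hw
  have hτ0 : -τ ≤ 0 := by linarith
  have hac : AbsolutelyContinuousOnInterval w (-τ) 0 := by
    refine AbsolutelyContinuousOnInterval.add ?_ ?_
    · have h1 : AbsolutelyContinuousOnInterval (fun t : ℝ => -t / τ) (-τ) 0 :=
        ContDiffOn.absolutelyContinuousOnInterval (by fun_prop)
      exact h1.smul (LipschitzWith.const P).lipschitzOnWith.absolutelyContinuousOnInterval
    · exact (collisionBump_absolutelyContinuous hτ).smul
        (LipschitzWith.const v).lipschitzOnWith.absolutelyContinuousOnInterval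
  have hbump0 : ∀ t ∈ Ioo (-τ) 0, 0 < collisionBump τ t := fun t ht =>
    (collisionBump_estimates ht).1
  have hderiv : ∀ t ∈ Ioo (-τ) 0, ‖deriv w t‖ ^ 2 ≤ ‖P‖ ^ 2 / τ ^ 2 + endpointWeight τ t := by
    intro t ht
    obtain ⟨d, hd, hd2⟩ := (collisionBump_estimates ht).2.2
    have h1 : HasDerivAt w ((-1 / τ) • P + d • v) t :=
      ((((hasDerivAt_id t).neg).div_const τ).smul_const P).add (hd.smul_const v)
    rw [h1.deriv, ← Complex.normSq_eq_norm_sq, Complex.normSq_apply]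
    simp only [Complex.add_re, Complex.add_im, Complex.real_smul, Complex.re_ofReal_mul,
      Complex.im_ofReal_mul]
    -- The cross term carries the inner product of P and v, which vanishes.
    have : (-1 / τ * P.re + d * v.re) * (-1 / τ * P.re + d * v.re) +
        (-1 / τ * P.im + d * v.im) * (-1 / τ * P.im + d * v.im) =
        (P.re ^ 2 + P.im ^ 2) / τ ^ 2 + d ^ 2 * (v.re ^ 2 + v.im ^ 2)
          - 2 * d / τ * (P.re * v.re + P.im * v.im) := by field_simp; ring
    rw [this, hPv, hv1, hPsq]
    linarith
  have hpot : ∀ t ∈ Ioo (-τ) 0, potential μ m q (w t) t ≤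
      ENNReal.ofReal (2 * (μ + m) * endpointWeight τ t) := by
    intro t ht
    obtain ⟨hg0, hg1, -⟩ := collisionBump_estimates ht
    have hcomp : (w t).re * v.re + (w t).im * v.im = collisionBump τ t := by
      simp only [hw, Complex.add_re, Complex.add_im, Complex.real_smul, Complex.re_ofReal_mul,
        Complex.im_ofReal_mul]
      linear_combination (-t / τ) * hPv + collisionBump τ t * hv1
    have hb1 : collisionBump τ t ≤ ‖w t‖ := hcomp ▸ component_le_norm hv1
    -- The component of q along v is nonpositive, so subtracting q can only increase the component
    -- of w along v.
    have hb2 : collisionBump τ t ≤ ‖w t - q t‖ := by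
      refine le_trans ?_ (component_le_norm hv1)
      obtain ⟨h1, h2⟩ := hq t (Ioo_subset_Icc_self ht)
      rw [Complex.sub_re, Complex.sub_im, h1, ← hcomp]
      nlinarith
    calc potential μ m q (w t) t
        ≤ ENNReal.ofReal (μ / collisionBump τ t) + ENNReal.ofReal (m / collisionBump τ t) :=
          add_le_add (ofReal_div_enorm_le hg0 hb1) (ofReal_div_enorm_le hg0 hb2)
      _ = ENNReal.ofReal ((μ + m) * (1 / collisionBump τ t)) := by
          rw [← ENNReal.ofReal_add (by positivity) (by positivity)]; congr 1; ring
      _ ≤ _ := ENNReal.ofReal_le_ofReal (by nlinarith)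
  have hwnn : ∀ t ∈ Ioo (-τ) 0, 0 ≤ endpointWeight τ t := fun t ht =>
    add_nonneg (Real.rpow_nonneg (by linarith [ht.1]) _) (Real.rpow_nonneg (by linarith [ht.2]) _)
  have hact : action μ m q (-τ) 0 w ≤
      ENNReal.ofReal (‖P‖ ^ 2 / (2 * τ) + (3 + 12 * (μ + m)) * τ ^ (1 / 3 : ℝ)) := by
    -- The weight enters with 1/2 from the kinetic energy and 2(μ + m) from the potential; its
    -- integral is 6τ^(1/3), whence 3 + 12(μ + m).
    set F : ℝ → ℝ := fun t => ‖P‖ ^ 2 / (2 * τ ^ 2) + (1 / 2 + 2 * (μ + m)) * endpointWeight τ t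
      with hF
    have hFi : IntervalIntegrable F volume (-τ) 0 :=
      intervalIntegrable_const.add ((intervalIntegrable_endpointWeight τ).const_mul _)
    have hFint : ∫ t in (-τ)..0, F t =
        ‖P‖ ^ 2 / (2 * τ) + (3 + 12 * (μ + m)) * τ ^ (1 / 3 : ℝ) := by
      rw [intervalIntegral.integral_add intervalIntegrable_const
        ((intervalIntegrable_endpointWeight τ).const_mul _), intervalIntegral.integral_const_mul,
        integral_endpointWeight, intervalIntegral.integral_const, smul_eq_mul]
      field_simp
      ring
    rw [← hFint, intervalIntegral.integral_of_le hτ0, restrict_Ioc_eq_restrict_Icc,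
      ← restrict_Ioo_eq_restrict_Icc, ofReal_integral_eq_lintegral_ofReal]
    · rw [action, ← restrict_Ioo_eq_restrict_Icc]
      refine setLIntegral_mono' measurableSet_Ioo fun t ht => ?_
      rw [enorm_sq_div_two]
      refine (add_le_add_right (hpot t ht) _).trans ?_
      have := hwnn t ht
      rw [← ENNReal.ofReal_add (by positivity) (by positivity)]
      refine ENNReal.ofReal_le_ofReal ?_
      have h1 := hderiv t ht
      have h2 : ‖P‖ ^ 2 / (2 * τ ^ 2) = ‖P‖ ^ 2 / τ ^ 2 / 2 := by field_simp
      simp only [hF, h2]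
      linarith
    · rw [← IntegrableOn, ← integrableOn_Icc_iff_integrableOn_Ioo]
      exact (intervalIntegrable_iff_integrableOn_Icc_of_le hτ0).1 hFi
    · refine (ae_restrict_iff' measurableSet_Ioo).2 (Eventually.of_forall fun t ht => ?_)
      have := hwnn t ht
      simp only [hF, Pi.zero_apply]
      positivity
  refine ⟨w, memH1_iff.2 ⟨hac, ?_⟩, ?_, ?_, hact⟩
  · have h1 : ∫⁻ t in Icc (-τ) 0, ‖deriv w t‖ₑ ^ 2 ≤ 2 * action μ m q (-τ) 0 w := by
      rw [action, ← lintegral_const_mul' _ _ (by simp)]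
      refine lintegral_mono fun t => ?_
      rw [mul_add, ENNReal.mul_div_cancel (by simp) (by simp)]
      exact le_self_add
    refine h1.trans_lt (ENNReal.mul_lt_top (by simp) (hact.trans_lt ENNReal.ofReal_lt_top))
  · simp [hw, collisionBump, hτ.ne']
  · simp [hw, collisionBump]

/-! ### The upper bound |z| = O(|t|^(2/3)) -/

section Upper

variable {μ m T : ℝ} {q z : ℝ → ℂ} {A A₀ : Set ℂ}

/-- Finiteness is what allows the unchanged pieces to be cancelled in `IsActionMinimizer.action_le`.
-/
theorem IsActionMinimizer.action_ne_top (hμ : 0 < μ) (hm : 0 < m) (hT : 0 < T)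
    (hq : ∀ t ∈ Icc (-T) 0, (q t).im = 0 ∧ (q t).re ≤ 0)
    (hz : IsActionMinimizer μ m q (-T) 0 A A₀ z) (hz0 : z 0 = 0) :
    action μ m q (-T) 0 z ≠ ⊤ := by
  obtain ⟨w, hw, hw1, hw2, hact⟩ := exists_path_to_collision hμ hm hT hq (z (-T))
  refine ((hz.2 w ⟨hw, hw1 ▸ hz.1.2.1, ?_⟩).trans_lt (hact.trans_lt ENNReal.ofReal_lt_top)).ne
  rw [hw2, ← hz0]
  exact hz.1.2.2

/-- Time is written as -x³, so that the powers 1/3 and 2/3 of |t| become x and x². -/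
theorem IsActionMinimizer.action_le_to_collision (hμ : 0 < μ) (hm : 0 < m) (hT : 0 < T)
    (hq : ∀ t ∈ Icc (-T) 0, (q t).im = 0 ∧ (q t).re ≤ 0)
    (hz : IsActionMinimizer μ m q (-T) 0 A A₀ z) (hz0 : z 0 = 0) {x : ℝ} (hx : 0 < x)
    (hxT : x ^ 3 ≤ T) :
    action μ m q (-x ^ 3) 0 z ≤
      ENNReal.ofReal (‖z (-x ^ 3)‖ ^ 2 / (2 * x ^ 3) + (3 + 12 * (μ + m)) * x) := by
  have hx3 : 0 < x ^ 3 := by positivity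
  obtain ⟨w, hw, hw1, hw2, hact⟩ := exists_path_to_collision hμ hm hx3
    (fun t ht => hq t ⟨by linarith [ht.1], ht.2⟩) (z (-x ^ 3))
  have hcbrt : (x ^ 3) ^ (1 / 3 : ℝ) = x := by
    rw [← Real.rpow_natCast, ← Real.rpow_mul hx.le]; norm_num
  rw [hcbrt] at hact
  exact (hz.action_le (hz.action_ne_top hμ hm hT hq hz0) (by linarith) (by linarith) le_rfl hw hw1
    (hw2.trans hz0.symm)).trans hact

theorem lintegral_kinetic_le_action {a b : ℝ} :
    ∫⁻ t in Icc a b, ‖deriv z t‖ₑ ^ 2 / 2 ≤ action μ m q a b z :=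
  lintegral_mono fun _ => le_self_add

theorem ofReal_sq_norm_sub_le_action {a b : ℝ} (hab : a < b) (hz : MemH1 a b z) :
    ENNReal.ofReal (‖z b - z a‖ ^ 2 / (2 * (b - a))) ≤ action μ m q a b z :=
  (ofReal_sq_norm_sub_le_lintegral hab hz.1).trans lintegral_kinetic_le_action

/-- With a = z(-τ), b = z(-2τ), τ = x³, the kinetic energy on the two halves is at least (|a - b|² +
|a|²)/(2τ), against the upper bound |b|²/(4τ) + O(x). The difference of the quadratic terms is
exactly |a - b/2|²/τ. -/
theorem IsActionMinimizer.norm_halving (hμ : 0 < μ) (hm : 0 < m) (hT : 0 < T)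
    (hq : ∀ t ∈ Icc (-T) 0, (q t).im = 0 ∧ (q t).re ≤ 0)
    (hz : IsActionMinimizer μ m q (-T) 0 A A₀ z) (hz0 : z 0 = 0) {x c : ℝ} (hx : 0 < x)
    (hc : 0 < c) (hc3 : c ^ 3 = 2) (hxT : (c * x) ^ 3 ≤ T) :
    ‖z (-x ^ 3)‖ ≤ ‖z (-(c * x) ^ 3)‖ / 2 + √(2 * (3 + 12 * (μ + m))) * x ^ 2 := by
  have hx3 : 0 < x ^ 3 := by positivity
  have hcx : (c * x) ^ 3 = 2 * x ^ 3 := by rw [mul_pow, hc3]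
  have hc2 : c ≤ 2 := by
    by_contra! h
    nlinarith [pow_lt_pow_left₀ h zero_le_two (n := 3) (by norm_num)]
  have h1 := hz.action_le_to_collision hμ hm hT hq hz0 (x := c * x) (by positivity) hxT
  rw [action_add (b := -x ^ 3) (by rw [hcx]; linarith) (by linarith)] at h1
  have hH := hz.1.1
  have h2 := (add_le_add
    (ofReal_sq_norm_sub_le_action (μ := μ) (m := m) (q := q) (a := -(c * x) ^ 3) (b := -x ^ 3)
      (by rw [hcx]; linarith) (hH.mono (by linarith) (by rw [hcx]; linarith) (by linarith)))
    (ofReal_sq_norm_sub_le_action (μ := μ) (m := m) (q := q) (a := -x ^ 3) (b := 0)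
      (by linarith) (hH.mono (by linarith) (by linarith) le_rfl))).trans h1
  rw [hcx] at h2 ⊢
  set a := z (-x ^ 3)
  set b := z (-(2 * x ^ 3))
  set k := 3 + 12 * (μ + m)
  have hk : 0 < k := by positivity
  have e1 : -x ^ 3 - -(2 * x ^ 3) = x ^ 3 := by ring
  have e2 : 0 - -x ^ 3 = x ^ 3 := by ring
  rw [hz0, zero_sub, norm_neg, e1, e2, ← ENNReal.ofReal_add (by positivity) (by positivity),
    ENNReal.ofReal_le_ofReal_iff (by positivity)] at h2
  have h3 : ‖a - b‖ ^ 2 + ‖a‖ ^ 2 - ‖b‖ ^ 2 / 2 ≤ 2 * k * (c * x) * x ^ 3 := by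
    have : (‖a - b‖ ^ 2 / (2 * x ^ 3) + ‖a‖ ^ 2 / (2 * x ^ 3)) * (2 * x ^ 3) ≤
      (‖b‖ ^ 2 / (2 * (2 * x ^ 3)) + k * (c * x)) * (2 * x ^ 3) := by gcongr
    field_simp at this
    nlinarith
  have h4 : ‖a - b‖ ^ 2 + ‖a‖ ^ 2 - ‖b‖ ^ 2 / 2 = 2 * ‖a - b / 2‖ ^ 2 := by
    simp only [← Complex.normSq_eq_norm_sq, Complex.normSq_apply, Complex.sub_re, Complex.sub_im,
      Complex.div_ofNat_re, Complex.div_ofNat_im]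
    ring
  have h5 : ‖a - b / 2‖ ^ 2 ≤ (√(2 * k) * x ^ 2) ^ 2 := by
    rw [mul_pow, Real.sq_sqrt (by positivity)]
    have : k * x ^ 4 * c ≤ k * x ^ 4 * 2 := by gcongr
    nlinarith
  have h6 := le_of_sq_le_sq h5 (by positivity)
  calc ‖a‖ = ‖b / 2 + (a - b / 2)‖ := by congr 1; ring
    _ ≤ ‖b / 2‖ + ‖a - b / 2‖ := norm_add_le _ _
    _ ≤ _ := by
      rw [norm_div]
      simpa using h6

theorem exists_cbrt {y : ℝ} (hy : 0 < y) : ∃ x : ℝ, 0 < x ∧ x ^ 3 = y :=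
  ⟨y ^ (1 / 3 : ℝ), by positivity, by rw [← Real.rpow_natCast, ← Real.rpow_mul hy.le]; norm_num⟩

/-- A minimizer ending at the collision is `O (|t| ^ (2 / 3))`. -/
theorem IsActionMinimizer.exists_norm_le (hμ : 0 < μ) (hm : 0 < m) (hT : 0 < T)
    (hq : ∀ t ∈ Icc (-T) 0, (q t).im = 0 ∧ (q t).re ≤ 0)
    (hz : IsActionMinimizer μ m q (-T) 0 A A₀ z) (hz0 : z 0 = 0) :
    ∃ K, 0 < K ∧ ∀ x, 0 < x → x ^ 3 ≤ T → ‖z (-x ^ 3)‖ ≤ K * x ^ 2 := by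
  obtain ⟨c, hc, hc3⟩ := exists_cbrt (y := 2) two_pos
  obtain ⟨X, hX, hX3⟩ := exists_cbrt (y := T / 2) (by linarith)
  obtain ⟨M, hM⟩ := hz.1.1.1.exists_bound
  rw [uIcc_of_le (by linarith)] at hM
  have hM0 : 0 ≤ M := (norm_nonneg _).trans (hM 0 ⟨by linarith, le_rfl⟩)
  set D := √(2 * (3 + 12 * (μ + m)))
  have hD : 0 < D := Real.sqrt_pos.2 (by positivity)
  -- Doubling the time multiplies x² by c² ≤ 8/5, so halving contracts the constant by 4/5; the
  -- remaining fifth absorbs D once the constant is at least 5D.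
  have hcsq : c ^ 2 ≤ 8 / 5 := by
    by_contra! h
    nlinarith [pow_lt_pow_left₀ h (by norm_num) (n := 3) (by norm_num), pow_succ c 3]
  -- Induction on the number of doublings that bring the time into [T/2, T], where the bound M
  -- suffices.
  have key : ∀ n : ℕ, ∀ x, 0 < x → x ^ 3 ≤ T → T / 2 ≤ 2 ^ n * x ^ 3 →
      ‖z (-x ^ 3)‖ ≤ (M / X ^ 2 + 5 * D) * x ^ 2 := by
    intro n
    induction n with
    | zero =>
      intro x hx hxT hn
      have hXx : X ≤ x := by
        by_contra! h
        nlinarith [pow_lt_pow_left₀ h hx.le (n := 3) (by norm_num)]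
      calc ‖z (-x ^ 3)‖ ≤ M := hM _ ⟨by linarith, by linarith [pow_pos hx 3]⟩
        _ = M / X ^ 2 * X ^ 2 := by field_simp
        _ ≤ (M / X ^ 2 + 5 * D) * x ^ 2 := by gcongr; linarith
    | succ n ih =>
      intro x hx hxT hn
      by_cases h : T / 2 ≤ 2 ^ n * x ^ 3
      · exact ih x hx hxT h
      have hcx : (c * x) ^ 3 = 2 * x ^ 3 := by rw [mul_pow, hc3]
      have hcT : (c * x) ^ 3 ≤ T := by
        have : x ^ 3 ≤ 2 ^ n * x ^ 3 := le_mul_of_one_le_left (by positivity) (one_le_pow₀ one_le_two)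
        rw [hcx]; linarith
      have h1 := ih (c * x) (by positivity) hcT (by rw [hcx]; rw [pow_succ] at hn; linarith)
      have h2 := hz.norm_halving hμ hm hT hq hz0 hx hc hc3 hcT
      have h3 : (M / X ^ 2 + 5 * D) * x ^ 2 * c ^ 2 ≤ (M / X ^ 2 + 5 * D) * x ^ 2 * (8 / 5) := by
        gcongr
      have h4 : 0 ≤ M / X ^ 2 * x ^ 2 := by positivity
      nlinarith
  refine ⟨M / X ^ 2 + 5 * D, by positivity, fun x hx hxT => ?_⟩
  obtain ⟨n, hn⟩ := pow_unbounded_of_one_lt (T / 2 / x ^ 3) one_lt_two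
  rw [div_lt_iff₀ (by positivity)] at hn
  exact key n x hx hxT hn.le

theorem IsActionMinimizer.exists_action_le (hμ : 0 < μ) (hm : 0 < m) (hT : 0 < T)
    (hq : ∀ t ∈ Icc (-T) 0, (q t).im = 0 ∧ (q t).re ≤ 0)
    (hz : IsActionMinimizer μ m q (-T) 0 A A₀ z) (hz0 : z 0 = 0) :
    ∃ C, 0 < C ∧ ∀ x, 0 < x → x ^ 3 ≤ T → action μ m q (-x ^ 3) 0 z ≤ ENNReal.ofReal (C * x) := by
  obtain ⟨K, hK, h⟩ := hz.exists_norm_le hμ hm hT hq hz0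
  refine ⟨K ^ 2 / 2 + (3 + 12 * (μ + m)), by positivity, fun x hx hxT => ?_⟩
  refine (hz.action_le_to_collision hμ hm hT hq hz0 hx hxT).trans (ENNReal.ofReal_le_ofReal ?_)
  have h1 : ‖z (-x ^ 3)‖ ^ 2 ≤ (K * x ^ 2) ^ 2 := by gcongr; exact h x hx hxT
  have h2 : ‖z (-x ^ 3)‖ ^ 2 / (2 * x ^ 3) ≤ (K * x ^ 2) ^ 2 / (2 * x ^ 3) := by gcongr
  have h3 : (K * x ^ 2) ^ 2 / (2 * x ^ 3) = K ^ 2 / 2 * x := by field_simp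
  linarith

end Upper

/-! ### The cost of a close passage at the center -/

/-- Kinetic energy plus the attraction of the center. -/
noncomputable def centralAction (μ a b : ℝ) (z : ℝ → ℂ) : ENNReal :=
  ∫⁻ t in Icc a b, (‖deriv z t‖ₑ ^ 2 / 2 + ENNReal.ofReal μ / ‖z t‖ₑ)

theorem centralAction_add {μ a b c : ℝ} {z : ℝ → ℂ} (hab : a ≤ b) (hbc : b ≤ c) :
    centralAction μ a c z = centralAction μ a b z + centralAction μ b c z :=
  setLIntegral_Icc_add hab hbc

theorem centralAction_le_action {μ m a b : ℝ} {q z : ℝ → ℂ} :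
    centralAction μ a b z ≤ action μ m q a b z :=
  lintegral_mono fun _ => add_le_add_right le_self_add _

theorem ofReal_div_le_div_enorm {k r : ℝ} {w : ℂ} (hk : 0 < k) (h : ‖w‖ ≠ 0 → r ≤ k / ‖w‖) :
    ENNReal.ofReal r ≤ ENNReal.ofReal k / ‖w‖ₑ := by
  by_cases hw : ‖w‖ = 0
  · have : ‖w‖ₑ = 0 := by simpa using hw
    rw [this, ENNReal.div_zero (by simpa using hk)]
    exact le_top
  · have hpos : 0 < ‖w‖ := lt_of_le_of_ne (norm_nonneg _) (Ne.symm hw)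
    rw [← ofReal_norm, ← ENNReal.ofReal_div_of_pos hpos]
    exact ENNReal.ofReal_le_ofReal (h hw)

theorem ofReal_mul_div_le_action {μ m ρ a b : ℝ} {q z : ℝ → ℂ} (hμ : 0 < μ) (hab : a ≤ b)
    (h : ∀ t ∈ Icc a b, ‖z t‖ ≤ ρ) :
    ENNReal.ofReal ((b - a) * (μ / ρ)) ≤ action μ m q a b z := by
  calc ENNReal.ofReal ((b - a) * (μ / ρ)) = ∫⁻ _ in Icc a b, ENNReal.ofReal (μ / ρ) := by
        rw [setLIntegral_const, Real.volume_Icc, ENNReal.ofReal_mul (by linarith), mul_comm]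
    _ ≤ _ := by
        refine setLIntegral_mono' measurableSet_Icc fun t ht => ?_
        refine le_trans ?_ (le_add_self.trans' le_self_add)
        refine ofReal_div_le_div_enorm hμ fun h0 => ?_
        have : 0 < ‖z t‖ := lt_of_le_of_ne (norm_nonneg _) (Ne.symm h0)
        gcongr
        exact h t ht

/-- Φ is a subsolution of the radial Hamilton–Jacobi equation at energy -k, so the Lagrangian
dominates |dΦ/dt| + k. -/
theorem ofReal_calibration_le_centralAction {μ a b k : ℝ} (hμ : 0 < μ) (hk : 0 ≤ k) (hab : a ≤ b)
    {z : ℝ → ℂ} (hz : AbsolutelyContinuousOnInterval z a b) {Φ Φ' : ℝ → ℝ}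
    (hΦ : ∀ r, 0 ≤ r → HasDerivAt Φ (Φ' r) r) (hΦ' : ContinuousOn Φ' (Ici 0))
    (hcal : ∀ t ∈ Icc a b, ‖z t‖ ≠ 0 → Φ' ‖z t‖ ^ 2 / 2 + k ≤ μ / ‖z t‖) :
    ENNReal.ofReal (|Φ ‖z b‖ - Φ ‖z a‖| + (b - a) * k) ≤ centralAction μ a b z := by
  have key := ofReal_abs_sub_le_lintegral hab hz 0 hΦ hΦ'
  simp only [sub_zero] at key
  have hkint : ENNReal.ofReal ((b - a) * k) = ∫⁻ _ in Icc a b, ENNReal.ofReal k := by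
    rw [setLIntegral_const, Real.volume_Icc, ENNReal.ofReal_mul (by linarith), mul_comm]
  rw [ENNReal.ofReal_add (abs_nonneg _) (mul_nonneg (by linarith) hk), hkint]
  refine (add_le_add_left key _).trans ?_
  rw [← lintegral_add_right _ measurable_const]
  refine setLIntegral_mono' measurableSet_Icc fun t ht => ?_
  rw [add_assoc, ← ENNReal.ofReal_add (by positivity) hk]
  exact add_le_add_right (ofReal_div_le_div_enorm hμ (hcal t ht)) _

/-- The zero-energy solution 2√(2μr), shifted by δ to be differentiable at the collision; the shift
only lowers Φ'. -/
theorem parabolic_calibration {μ δ : ℝ} (hμ : 0 < μ) (hδ : 0 < δ) :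
    (∀ r, 0 ≤ r → HasDerivAt (fun r => 2 * √(2 * μ) * √(r + δ)) (√(2 * μ) / √(r + δ)) r) ∧
    ContinuousOn (fun r => √(2 * μ) / √(r + δ)) (Ici 0) ∧
    ∀ r, 0 < r → (√(2 * μ) / √(r + δ)) ^ 2 / 2 + 0 ≤ μ / r := by
  refine ⟨fun r hr => ?_, ?_, fun r hr => ?_⟩
  · have hs := Real.sqrt_pos.2 (by linarith : 0 < r + δ)
    refine ((((hasDerivAt_id r).add_const δ).sqrt (by simp; positivity)).const_mul _).congr_deriv ?_
    simp; field_simp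
  · refine continuousOn_const.div (by fun_prop) fun r hr => ?_
    have : (0:ℝ) ≤ r := hr
    positivity
  · rw [div_pow, Real.sq_sqrt (by positivity), Real.sq_sqrt (by positivity), add_zero]
    rw [div_div, div_le_div_iff₀ (by positivity) hr]
    nlinarith

/-- A calibration at energy -μ/ρ. For δ = 0 its slope is √(2μ/r)(1 - r/ρ), below the exact
√(2μ/r)√(1 - r/ρ) but with an elementary primitive; its total increment is 4/3 instead of π/2 times
√(2μρ), which is still enough. -/
theorem elliptic_calibration {μ ρ δ : ℝ} (hμ : 0 < μ) (hρ : 0 < ρ) (hδ : 0 < δ) :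
    (∀ r, 0 ≤ r → HasDerivAt
      (fun r => √(2 * μ) * (2 * √(r + δ) - 2 / 3 * ((r + δ) * √(r + δ)) / (ρ + δ)))
      (√(2 * μ) * (1 / √(r + δ) - √(r + δ) / (ρ + δ))) r) ∧
    ContinuousOn (fun r => √(2 * μ) * (1 / √(r + δ) - √(r + δ) / (ρ + δ))) (Ici 0) ∧
    ∀ r, 0 < r → r ≤ ρ →
      (√(2 * μ) * (1 / √(r + δ) - √(r + δ) / (ρ + δ))) ^ 2 / 2 + μ / ρ ≤ μ / r := by
  refine ⟨fun r hr => ?_, ?_, fun r hr hrρ => ?_⟩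
  · have hs := Real.sqrt_pos.2 (by linarith : 0 < r + δ)
    have h1 := ((hasDerivAt_id r).add_const δ)
    have h2 := h1.sqrt (by simp; positivity)
    refine (((h2.const_mul 2).sub (((h1.mul h2).const_mul (2 / 3)).div_const (ρ + δ))).const_mul
      (√(2 * μ))).congr_deriv ?_
    have hsq := Real.mul_self_sqrt (by linarith : 0 ≤ r + δ)
    simp only [id_eq]
    field_simp
    linear_combination hsq
  · refine continuousOn_const.mul ((continuousOn_const.div (by fun_prop) fun r hr => ?_).sub
      (by fun_prop))
    have : (0:ℝ) ≤ r := hr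
    positivity
  · have hs := Real.sqrt_pos.2 (by linarith : 0 < r + δ)
    have e : 1 / √(r + δ) - √(r + δ) / (ρ + δ) = (ρ - r) / ((ρ + δ) * √(r + δ)) := by
      have hsq := Real.mul_self_sqrt (by linarith : 0 ≤ r + δ)
      field_simp
      linear_combination -hsq
    rw [e, mul_pow, div_pow, mul_pow, Real.sq_sqrt (by positivity), Real.sq_sqrt (by positivity)]
    have h1 : (ρ - r) ^ 2 / ((ρ + δ) ^ 2 * (r + δ)) ≤ (ρ - r) / (ρ * r) := by
      rw [div_le_div_iff₀ (by positivity) (by positivity)]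
      have h2 : 0 ≤ ρ - r := by linarith
      have h3 : (ρ - r) * (ρ * r) ≤ (ρ + δ) ^ 2 * (r + δ) := by
        have : (ρ - r) * (ρ * r) ≤ (ρ + δ) * ((ρ + δ) * (r + δ)) := by
          gcongr <;> linarith
        linarith
      nlinarith
    have h2 : μ / r - μ / ρ = μ * ((ρ - r) / (ρ * r)) := by field_simp
    have h3 := mul_le_mul_of_nonneg_left h1 hμ.le
    linarith

/-- Lower bounds for the action of an excursion from the circle of radius `ρ` to a tiny distance
and back. -/
theorem centralAction_lower_bounds {μ ρ a b t₀ : ℝ} {z : ℝ → ℂ} (hμ : 0 < μ) (hρ : 0 < ρ)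
    (hat : a ≤ t₀) (htb : t₀ ≤ b)
    (hz : AbsolutelyContinuousOnInterval z a b) (hza : ‖z a‖ = ρ) (hzb : ‖z b‖ = ρ)
    (hz0 : ‖z t₀‖ ≤ ρ / 20000) (hle : ∀ t ∈ Icc a b, ‖z t‖ ≤ ρ) :
    ENNReal.ofReal (5.5 * (√μ * √ρ)) ≤ centralAction μ a b z ∧
    ENNReal.ofReal (3.6 * (√μ * √ρ) + (b - a) * (μ / ρ)) ≤ centralAction μ a b z := by
  set δ := ρ / 20000 with hδ
  have hδ0 : 0 < δ := by positivity
  have hz1 : AbsolutelyContinuousOnInterval z a t₀ := hz.mono (by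
    rw [uIcc_of_le hat, uIcc_of_le (hat.trans htb)]; exact Icc_subset_Icc_right htb)
  have hz2 : AbsolutelyContinuousOnInterval z t₀ b := hz.mono (by
    rw [uIcc_of_le htb, uIcc_of_le (hat.trans htb)]; exact Icc_subset_Icc_left hat)
  have hsum : ∀ (Φ : ℝ → ℝ) (k l : ℝ), 0 ≤ k → 0 ≤ l →
      (ENNReal.ofReal (|Φ ‖z t₀‖ - Φ ‖z a‖| + (t₀ - a) * k) ≤ centralAction μ a t₀ z) →
      (ENNReal.ofReal (|Φ ‖z b‖ - Φ ‖z t₀‖| + (b - t₀) * k) ≤ centralAction μ t₀ b z) →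
      l ≤ Φ ρ - Φ ‖z t₀‖ →
      ENNReal.ofReal (2 * l + (b - a) * k) ≤ centralAction μ a b z := by
    intro Φ k l hk hl h1 h2 h3
    rw [centralAction_add hat htb]
    refine le_trans ?_ (add_le_add h1 h2)
    rw [← ENNReal.ofReal_add (add_nonneg (abs_nonneg _) (mul_nonneg (by linarith) hk))
      (add_nonneg (abs_nonneg _) (mul_nonneg (by linarith) hk)), hza, hzb]
    refine ENNReal.ofReal_le_ofReal ?_
    have h4 := le_abs_self (Φ ρ - Φ ‖z t₀‖)
    have h5 := neg_abs_le (Φ ‖z t₀‖ - Φ ρ)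
    linarith
  have hsqrt2 : √(2 * μ) = √2 * √μ := Real.sqrt_mul zero_le_two μ
  have h2 : 1.414 ≤ √2 := Real.le_sqrt_of_sq_le (by norm_num)
  have hμ0 := Real.sqrt_pos.2 hμ
  have hρ0 := Real.sqrt_pos.2 hρ
  have hμρ : 0 < √μ * √ρ := by positivity
  -- The origin of 20000: |z t₀| + δ ≤ ρ/10000.
  have hr0 : √(‖z t₀‖ + δ) ≤ √ρ / 100 := by
    rw [Real.sqrt_le_left (by positivity), div_pow, Real.sq_sqrt hρ.le]
    rw [hδ] at hz0 ⊢; linarith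
  have hρδ : √ρ ≤ √(ρ + δ) := Real.sqrt_le_sqrt (by linarith)
  have hpos : ∀ t, ‖z t‖ ≠ 0 → 0 < ‖z t‖ := fun t h =>
    lt_of_le_of_ne (norm_nonneg _) (Ne.symm h)
  constructor
  · obtain ⟨c1, c2, c3⟩ := parabolic_calibration hμ hδ0
    have := hsum (fun r => 2 * √(2 * μ) * √(r + δ)) 0 (2.75 * (√μ * √ρ)) le_rfl (by positivity)
      (ofReal_calibration_le_centralAction hμ le_rfl hat hz1 c1 c2 fun t _ h => c3 _ (hpos t h))
      (ofReal_calibration_le_centralAction hμ le_rfl htb hz2 c1 c2 fun t _ h => c3 _ (hpos t h)) ?_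
    · refine le_trans (ENNReal.ofReal_le_ofReal ?_) this
      linarith
    · simp only [hsqrt2]
      have h6 : √2 * √μ * (0.99 * √ρ) ≤ √2 * √μ * (√(ρ + δ) - √(‖z t₀‖ + δ)) := by
        gcongr; linarith
      have h7 : 1.414 * (√μ * √ρ) ≤ √2 * (√μ * √ρ) := by gcongr
      nlinarith
  · obtain ⟨c1, c2, c3⟩ := elliptic_calibration hμ hρ hδ0
    have hk : 0 ≤ μ / ρ := by positivity
    have := hsum (fun r => √(2 * μ) * (2 * √(r + δ) - 2 / 3 * ((r + δ) * √(r + δ)) / (ρ + δ)))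
      (μ / ρ) (1.8 * (√μ * √ρ)) hk (by positivity)
      (ofReal_calibration_le_centralAction hμ hk hat hz1 c1 c2 fun t ht h =>
        c3 _ (hpos t h) (hle t ⟨ht.1, ht.2.trans htb⟩))
      (ofReal_calibration_le_centralAction hμ hk htb hz2 c1 c2 fun t ht h =>
        c3 _ (hpos t h) (hle t ⟨hat.trans ht.1, ht.2⟩)) ?_
    · refine le_trans (ENNReal.ofReal_le_ofReal ?_) this
      linarith
    · simp only [hsqrt2]
      have e : 2 * √(ρ + δ) - 2 / 3 * ((ρ + δ) * √(ρ + δ)) / (ρ + δ) = 4 / 3 * √(ρ + δ) := by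
        field_simp; ring
      have e2 : 0 ≤ 2 / 3 * ((‖z t₀‖ + δ) * √(‖z t₀‖ + δ)) / (ρ + δ) := by positivity
      -- Here 4/3 - 2/100 > 1.31, and 2 · 1.31 · 1.414 > 3.6.
      have h6 : √2 * √μ * (1.31 * √ρ) ≤ √2 * √μ * (2 * √(ρ + δ) -
          2 / 3 * ((ρ + δ) * √(ρ + δ)) / (ρ + δ) - (2 * √(‖z t₀‖ + δ) -
            2 / 3 * ((‖z t₀‖ + δ) * √(‖z t₀‖ + δ)) / (ρ + δ))) := by
        gcongr; rw [e]; linarith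
      have h7 : 1.414 * (√μ * √ρ) ≤ √2 * (√μ * √ρ) := by gcongr
      nlinarith

/-! ### Competitors: the circular arc and the time compression -/

/-- Connecting two points of a circle around the center by an arc of uniform speed. -/
theorem exists_circular_arc {μ m ρ d a b : ℝ} (hμ : 0 < μ) (hm : 0 < m) (hρ : 0 < ρ) (hd : 0 < d)
    (hab : a < b) {q : ℝ → ℂ} (hq : ∀ t ∈ Icc a b, ρ + d ≤ ‖q t‖) {P Q : ℂ} (hP : ‖P‖ = ρ)
    (hQ : ‖Q‖ = ρ) :
    ∃ w, MemH1 a b w ∧ w a = P ∧ w b = Q ∧ action μ m q a b w ≤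
      ENNReal.ofReal (Real.pi ^ 2 * ρ ^ 2 / (2 * (b - a)) + (b - a) * (μ / ρ) +
        (b - a) * (m / d)) := by
  have hba : 0 < b - a := by linarith
  have hP0 : P ≠ 0 := norm_pos_iff.1 (hP ▸ hρ)
  -- The principal argument makes the arc at most half a turn, so its speed is at most πρ/(b - a).
  set α := Complex.arg (Q / P) with hα
  set w : ℝ → ℂ := fun t => P * Complex.exp (((t - a) / (b - a) * α : ℝ) * Complex.I) with hw
  have hwn : ∀ t, ‖w t‖ = ρ := fun t => by
    simp only [hw]
    rw [norm_mul, Complex.norm_exp_ofReal_mul_I, mul_one, hP]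
  have hderiv : ∀ t, ‖deriv w t‖ ≤ ρ * Real.pi / (b - a) := by
    intro t
    have h1 : HasDerivAt (fun t : ℝ => (t - a) / (b - a) * α) (1 / (b - a) * α) t :=
      (((hasDerivAt_id t).sub_const a).div_const (b - a)).mul_const α
    have h2 := ((h1.ofReal_comp.mul_const Complex.I).cexp).const_mul P
    rw [h2.deriv, norm_mul, norm_mul, Complex.norm_exp_ofReal_mul_I, hP, norm_mul, Complex.norm_I,
      Complex.norm_real, Real.norm_eq_abs, abs_mul, abs_of_pos (by positivity : 0 < 1 / (b - a))]
    have := Complex.abs_arg_le_pi (Q / P)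
    calc ρ * (1 * (1 / (b - a) * |α| * 1)) ≤ ρ * (1 * (1 / (b - a) * Real.pi * 1)) := by gcongr
      _ = _ := by ring
  have hfin : ∀ t, ‖deriv w t‖ₑ ^ 2 ≤ ENNReal.ofReal ((ρ * Real.pi / (b - a)) ^ 2) := fun t => by
    rw [← ofReal_norm, ← ENNReal.ofReal_pow (norm_nonneg _)]
    exact ENNReal.ofReal_le_ofReal (pow_le_pow_left₀ (norm_nonneg _) (hderiv t) 2)
  refine ⟨w, memH1_iff.2 ⟨ContDiffOn.absolutelyContinuousOnInterval ?_, ?_⟩, by simp [hw], ?_, ?_⟩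
  · have h1 : ContDiff ℝ 1 (fun t : ℝ => (((t - a) / (b - a) * α : ℝ) : ℂ)) :=
      Complex.ofRealCLM.contDiff.comp
        (((contDiff_id.sub contDiff_const).div_const _).mul contDiff_const)
    exact (contDiff_const.mul (h1.mul contDiff_const).cexp).contDiffOn
  · refine (lintegral_mono hfin).trans_lt ?_
    rw [setLIntegral_const, Real.volume_Icc]
    exact ENNReal.mul_lt_top ENNReal.ofReal_lt_top ENNReal.ofReal_lt_top
  · have h1 : (b - a) / (b - a) * α = α := by rw [div_self hba.ne', one_mul]
    have h2 : ‖Q / P‖ = 1 := by rw [norm_div, hP, hQ, div_self hρ.ne']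
    have h3 := Complex.norm_mul_exp_arg_mul_I (Q / P)
    rw [h2, Complex.ofReal_one, one_mul] at h3
    simp only [hw]
    rw [h1, hα, h3, mul_div_cancel₀ _ hP0]
  · have hbound : ∀ t ∈ Icc a b, ‖deriv w t‖ₑ ^ 2 / 2 + potential μ m q (w t) t ≤
        ENNReal.ofReal ((ρ * Real.pi / (b - a)) ^ 2 / 2 + (μ / ρ + m / d)) := by
      intro t ht
      rw [ENNReal.ofReal_add (by positivity) (by positivity),
        ENNReal.ofReal_add (by positivity) (by positivity)]
      refine add_le_add ?_ (add_le_add (ofReal_div_enorm_le hρ (hwn t).ge)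
        (ofReal_div_enorm_le hd ?_))
      · rw [enorm_sq_div_two]
        refine ENNReal.ofReal_le_ofReal ?_
        gcongr
        exact hderiv t
      · rw [norm_sub_rev]
        have h1 := norm_sub_norm_le (q t) (w t)
        rw [hwn] at h1
        linarith [hq t ht]
    refine (setLIntegral_mono' measurableSet_Icc hbound).trans ?_
    rw [setLIntegral_const, Real.volume_Icc, ← ENNReal.ofReal_mul (by positivity)]
    refine ENNReal.ofReal_le_ofReal (le_of_eq ?_)
    field_simp
    ring

/-- Running through a path in shorter time, by an affine change of time fixing the left end. If
the moving center approaches and the path is closer to the origin than the center, then the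
potential does not increase. -/
theorem exists_time_compression {μ m a b b' : ℝ} (hab' : a < b') (hb : b' ≤ b)
    {q z : ℝ → ℂ} (hz : MemH1 a b z) (hq : ∀ t ∈ Icc a b, (q t).im = 0 ∧ (q t).re = -‖q t‖)
    (hanti : AntitoneOn (fun t => ‖q t‖) (Icc a b)) (hle : ∀ t ∈ Icc a b, ‖z t‖ ≤ ‖q t‖) :
    ∃ w, MemH1 a b' w ∧ w a = z a ∧ w b' = z b ∧ action μ m q a b' w ≤
      ENNReal.ofReal ((b - a) / (b' - a)) * action μ m q a b z := by
  have hba : 0 < b' - a := by linarith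
  set l := (b - a) / (b' - a) with hl
  have hl1 : 1 ≤ l := (one_le_div hba).2 (by linarith)
  have hl0 : 0 < l := by linarith
  set σ : ℝ → ℝ := fun t => l * t + (a - l * a) with hσ
  have hlb : l * (b' - a) = b - a := by rw [hl]; field_simp
  have hσa : σ a = a := by simp [hσ]
  have hσb : σ b' = b := by simp only [hσ]; linarith
  have hσmono : Monotone σ := fun x y hxy => by simp only [hσ]; gcongr
  have hσmaps : ∀ t ∈ Icc a b', σ t ∈ Icc a b := fun t ht =>
    ⟨hσa ▸ hσmono ht.1, hσb ▸ hσmono ht.2⟩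
  have hσge : ∀ t ∈ Icc a b', t ≤ σ t := fun t ht => by
    simp only [hσ]; nlinarith [ht.1]
  have himage : σ '' Icc a b' = Icc a b := by
    refine Subset.antisymm (image_subset_iff.2 hσmaps) fun s hs => ?_
    refine ⟨(s - (a - l * a)) / l, ⟨?_, ?_⟩, by simp only [hσ]; field_simp; ring⟩
    · rw [le_div_iff₀ hl0]; linarith [hs.1]
    · rw [div_le_iff₀ hl0]; nlinarith [hs.2]
  have hcov : ∀ F : ℝ → ENNReal, ∫⁻ s in Icc a b, F s =
      ∫⁻ t in Icc a b', ENNReal.ofReal l * F (σ t) := fun F => by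
    rw [← himage, lintegral_image_eq_lintegral_abs_deriv_mul measurableSet_Icc (f' := fun _ => l)
      (fun t _ => ?_) (fun x _ y _ hxy => ?_), abs_of_pos hl0]
    · exact ((((hasDerivAt_id t).const_mul l).add_const (a - l * a)).congr_deriv
        (mul_one l)).hasDerivWithinAt
    · simp only [hσ, add_left_inj] at hxy
      exact mul_left_cancel₀ hl0.ne' hxy
  have hderiv : ∀ t, deriv (z ∘ σ) t = l • deriv z (σ t) := fun t => by
    have h1 := deriv_comp_mul_left l (fun x => z (x + (a - l * a))) t
    rw [deriv_comp_add_const] at h1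
    exact h1
  have hensq : ∀ t, ‖deriv (z ∘ σ) t‖ₑ ^ 2 =
      ENNReal.ofReal l * (ENNReal.ofReal l * ‖deriv z (σ t)‖ₑ ^ 2) := fun t => by
    rw [hderiv, enorm_smul, mul_pow, Real.enorm_eq_ofReal hl0.le]
    ring
  have hone : 1 ≤ ENNReal.ofReal l := by simpa using ENNReal.ofReal_le_ofReal hl1
  refine ⟨z ∘ σ, memH1_iff.2 ⟨?_, ?_⟩, by simp [hσa], by simp [hσb], ?_⟩
  · refine AbsolutelyContinuousOnInterval.comp_monotone hz.1 (K := l) hσmono hl0.le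
      (fun x y => ?_) ?_
    · rw [Real.dist_eq, Real.dist_eq, show σ x - σ y = l * (x - y) by simp only [hσ]; ring,
        abs_mul, abs_of_pos hl0]
    · rwa [uIcc_of_le hab'.le, uIcc_of_le (hab'.le.trans hb)]
  · simp only [hensq]
    rw [lintegral_const_mul' _ _ ENNReal.ofReal_ne_top, ← hcov fun s => ‖deriv z s‖ₑ ^ 2]
    exact ENNReal.mul_lt_top ENNReal.ofReal_lt_top (memH1_iff.1 hz).2
  · rw [action, action, hcov, ← lintegral_const_mul' _ _ ENNReal.ofReal_ne_top]
    refine setLIntegral_mono' measurableSet_Icc fun t ht => ?_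
    rw [hensq, mul_add, mul_add, mul_div_assoc, mul_div_assoc]
    refine add_le_add_right ?_ _
    -- At the earlier time t the body q is farther left than at σ t, and |z(σ t)| ≤ |q(σ t)| puts
    -- the point to the right of both positions: its distance to q can only grow.
    have hpot : potential μ m q (z (σ t)) t ≤ potential μ m q (z (σ t)) (σ t) := by
      refine add_le_add_right (ENNReal.div_le_div_left ?_ _) _
      rw [← ofReal_norm, ← ofReal_norm]
      refine ENNReal.ofReal_le_ofReal ?_
      have htab : t ∈ Icc a b := ⟨ht.1, ht.2.trans hb⟩
      obtain ⟨h1, h2⟩ := hq t htab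
      obtain ⟨h3, h4⟩ := hq (σ t) (hσmaps t ht)
      have h5 := hanti htab (hσmaps t ht) (hσge t ht)
      have h6 := hle (σ t) (hσmaps t ht)
      have h7 := (abs_le.1 ((Complex.abs_re_le_norm (z (σ t))).trans h6)).1
      simp only at h5
      refine le_of_sq_le_sq ?_ (norm_nonneg _)
      rw [← Complex.normSq_eq_norm_sq, ← Complex.normSq_eq_norm_sq, Complex.normSq_apply,
        Complex.normSq_apply]
      simp only [Complex.sub_re, Complex.sub_im, h1, h2, h3, h4]
      nlinarith
    calc potential μ m q (z (σ t)) t ≤ 1 * (1 * potential μ m q (z (σ t)) (σ t)) := by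
          simpa using hpot
      _ ≤ _ := by gcongr

/-! ### First and last hitting times of a level -/

theorem exists_first_hitting {f : ℝ → ℝ} {s t ρ : ℝ} (hst : s ≤ t) (hf : ContinuousOn f (Icc s t))
    (hs : f s < ρ) (ht : ρ ≤ f t) :
    ∃ b, s < b ∧ b ≤ t ∧ f b = ρ ∧ ∀ u ∈ Icc s b, f u ≤ ρ := by
  have hcl : IsCompact (Icc s t ∩ f ⁻¹' Ici ρ) :=
    isCompact_Icc.of_isClosed_subset (hf.preimage_isClosed_of_isClosed isClosed_Icc isClosed_Ici)
      inter_subset_left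
  obtain ⟨b, ⟨hb, hbρ⟩, hmin⟩ := hcl.exists_isLeast ⟨t, ⟨hst, le_rfl⟩, ht⟩
  have hbρ' : ρ ≤ f b := hbρ
  have hbeq : f b = ρ := by
    obtain ⟨u, hu, hu'⟩ := intermediate_value_Icc hb.1 (hf.mono (Icc_subset_Icc_right hb.2))
      ⟨hs.le, hbρ'⟩
    have : b ≤ u := hmin ⟨⟨hu.1, hu.2.trans hb.2⟩, hu'.ge⟩
    rw [le_antisymm this hu.2, hu']
  refine ⟨b, lt_of_le_of_ne hb.1 fun h => ?_, hb.2, hbeq, fun u hu => ?_⟩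
  · rw [h] at hs; linarith
  · rcases hu.2.eq_or_lt with rfl | h
    · exact hbeq.le
    · by_contra! hlt
      exact not_le.2 h (hmin ⟨⟨hu.1, hu.2.trans hb.2⟩, hlt.le⟩)

theorem exists_last_hitting {f : ℝ → ℝ} {s t ρ : ℝ} (hst : s ≤ t) (hf : ContinuousOn f (Icc s t))
    (hs : ρ ≤ f s) (ht : f t < ρ) :
    ∃ a, s ≤ a ∧ a < t ∧ f a = ρ ∧ ∀ u ∈ Icc a t, f u ≤ ρ := by
  obtain ⟨b, h1, h2, h3, h4⟩ := exists_first_hitting (f := fun u => f (-u)) (s := -t) (t := -s)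
    (ρ := ρ) (by linarith)
    (hf.comp continuous_neg.continuousOn fun u hu => ⟨by linarith [hu.2], by linarith [hu.1]⟩)
    (by simpa using ht) (by simpa using hs)
  refine ⟨-b, by linarith, by linarith, h3, fun u hu => ?_⟩
  simpa using h4 (-u) ⟨by linarith [hu.2], by linarith [hu.1]⟩

/-! ### Exchanging a close passage for an arc -/

section Exchange

variable {μ m α ω ρ d E a₁ a b t₀ : ℝ} {q z : ℝ → ℂ} {A A₀ : Set ℂ}

/-- The minimizer against the competitor that gains time `β` on `[a₁, a]` and replaces the rest by
a circular arc. -/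
theorem IsActionMinimizer.action_le_exchange (hμ : 0 < μ) (hm : 0 < m)
    (hz : IsActionMinimizer μ m q α ω A A₀ z) (hfin : action μ m q α ω z ≠ ⊤)
    (hα : α ≤ a₁) (ha : a₁ < a) (hab : a < b) (hb : b ≤ ω) (hρ : 0 < ρ) (hd : 0 < d)
    (hE : 0 ≤ E) (hza : ‖z a‖ = ρ) (hzb : ‖z b‖ = ρ)
    (hq : ∀ t ∈ Icc a₁ b, (q t).im = 0 ∧ (q t).re = -‖q t‖)
    (hanti : AntitoneOn (fun t => ‖q t‖) (Icc a₁ b))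
    (hzq : ∀ t ∈ Icc a₁ a, ‖z t‖ ≤ ‖q t‖) (hqρ : ∀ t ∈ Icc a₁ b, ρ + d ≤ ‖q t‖)
    (hact : action μ m q a₁ b z ≤ ENNReal.ofReal E) {β : ℝ} (hβ : 0 ≤ β) (hβa : β < a - a₁) :
    action μ m q a b z ≤ ENNReal.ofReal (β / (a - a₁ - β) * E +
      (Real.pi ^ 2 * ρ ^ 2 / (2 * (b - a + β)) + (b - a + β) * (μ / ρ) + (b - a + β) * (m / d))) := by
  have hzH := hz.1.1
  obtain ⟨w₁, hw₁, hw₁a, hw₁b, hw₁act⟩ := exists_time_compression (μ := μ) (m := m) (q := q)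
    (a := a₁) (b := a) (b' := a - β) (by linarith) (by linarith)
    (hzH.mono hα ha.le (by linarith))
    (fun t ht => hq t ⟨ht.1, ht.2.trans hab.le⟩) (hanti.mono (Icc_subset_Icc_right hab.le)) hzq
  obtain ⟨w₂, hw₂, hw₂a, hw₂b, hw₂act⟩ := exists_circular_arc (m := m) (q := q) (a := a - β) (b := b)
    hμ hm hρ hd (by linarith) (fun t ht => hqρ t ⟨by linarith [ht.1], ht.2⟩) hza hzb
  have hmatch : w₁ (a - β) = w₂ (a - β) := hw₁b.trans hw₂a.symm
  have hle₁ : a₁ ≤ a - β := by linarith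
  have hle₂ : a - β ≤ b := by linarith
  have hmin := hz.action_le hfin hα (ha.le.trans hab.le) hb (hw₁.glue hle₁ hle₂ hw₂ hmatch)
    (by simp [hle₁, hw₁a]) (by
      rw [← hw₂b]
      exact (glue_eqOn_right (c := b) hmatch ⟨hle₂, le_rfl⟩).symm)
  have hZ₁ : action μ m q a₁ a z ≤ ENNReal.ofReal E := (action_mono le_rfl hab.le).trans hact
  rw [action_glue hle₁ hle₂ hmatch, action_add ha.le hab.le] at hmin
  have hL : 0 < a - a₁ - β := by linarith
  -- The 1 cancels against the action of z on [a₁, a]; only β/(a - a₁ - β) times that action is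
  -- paid.
  have hlam : (a - a₁) / (a - β - a₁) = 1 + β / (a - a₁ - β) := by
    rw [show a - β - a₁ = a - a₁ - β by ring]; field_simp; ring
  have hquot : 0 ≤ β / (a - a₁ - β) := by positivity
  rw [hlam, ENNReal.ofReal_add zero_le_one hquot, ENNReal.ofReal_one, add_mul, one_mul] at hw₁act
  have h1 := hmin.trans (add_le_add hw₁act hw₂act)
  rw [add_assoc, ENNReal.add_le_add_iff_left (hZ₁.trans_lt ENNReal.ofReal_lt_top).ne] at h1
  refine h1.trans ?_
  have e : b - (a - β) = b - a + β := by ring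
  have hY : 0 < b - a + β := by linarith
  rw [e, ENNReal.ofReal_add (mul_nonneg hquot hE) (by positivity), ENNReal.ofReal_mul hquot]
  gcongr

/-- A minimizer with a close passage at the center on the scale `ρ` forces `ρ` to be large. -/
theorem IsActionMinimizer.close_passage_estimate (hμ : 0 < μ) (hm : 0 < m)
    (hz : IsActionMinimizer μ m q α ω A A₀ z) (hfin : action μ m q α ω z ≠ ⊤)
    (hα : α ≤ a₁) (ha : a₁ < a) (hat : a < t₀) (htb : t₀ < b) (hb : b ≤ ω) (hρ : 0 < ρ)
    (hd : 0 < d) (hE : 0 ≤ E) (hza : ‖z a‖ = ρ) (hzb : ‖z b‖ = ρ)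
    (hzt : ‖z t₀‖ ≤ ρ / 20000) (hle : ∀ t ∈ Icc a b, ‖z t‖ ≤ ρ)
    (hq : ∀ t ∈ Icc a₁ b, (q t).im = 0 ∧ (q t).re = -‖q t‖)
    (hanti : AntitoneOn (fun t => ‖q t‖) (Icc a₁ b))
    (hzq : ∀ t ∈ Icc a₁ a, ‖z t‖ ≤ ‖q t‖) (hqρ : ∀ t ∈ Icc a₁ b, ρ + d ≤ ‖q t‖)
    (hact : action μ m q a₁ b z ≤ ENNReal.ofReal E) {θ : ℝ} (hθ : 0 < θ)
    (hθρ : θ * (√μ * √ρ) = ρ ^ 2) (hθa : 3 / 2 * θ < a - a₁) :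
    3 / 10 * (√μ * √ρ) ≤
      3 / 2 * θ / (a - a₁ - 3 / 2 * θ) * E + (b - a + 3 / 2 * θ) * (m / d) := by
  have hab : a < b := hat.trans htb
  have hzH := hz.1.1
  obtain ⟨hl1, hl2⟩ := centralAction_lower_bounds hμ hρ hat.le htb.le
    (hzH.mono (hα.trans ha.le) hab.le hb).1 hza hzb hzt hle
  have hex := fun β => hz.action_le_exchange hμ hm hfin hα ha hab hb hρ hd hE hza hzb hq hanti hzq
    hqρ hact (β := β)
  set g := √μ * √ρ with hg
  have hg0 : 0 < g := mul_pos (Real.sqrt_pos.2 hμ) (Real.sqrt_pos.2 hρ)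
  have hgsq : g ^ 2 = μ * ρ := by rw [hg, mul_pow, Real.sq_sqrt hμ.le, Real.sq_sqrt hρ.le]
  have hμρ : θ * (μ / ρ) = g := by
    have : θ * (μ * ρ) = g * ρ ^ 2 := by rw [← hgsq, ← hθρ]; ring
    field_simp
    nlinarith
  have hpi : Real.pi ^ 2 ≤ 9.9 := by
    have := Real.pi_lt_d4; nlinarith [Real.pi_pos]
  have hL : 0 < a - a₁ - 3 / 2 * θ := by linarith
  have hkin : ∀ Y, 3 / 2 * θ ≤ Y → Real.pi ^ 2 * ρ ^ 2 / (2 * Y) ≤ 3.3 * g := by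
    intro Y hY
    have hY0 : 0 < Y := by linarith
    rw [div_le_iff₀ (by positivity), ← hθρ]
    have h1 : Real.pi ^ 2 * (θ * g) ≤ 9.9 * (θ * g) := by gcongr
    have h2 : 3 / 2 * θ * g ≤ Y * g := by gcongr
    nlinarith
  -- A long excursion is replaced in its own time (β = 0, elliptic bound, gain 3.6 - 3.3); a short
  -- one is prolonged to 3θ/2 (parabolic bound, gain 5.5 - 3.3 - 1.5).
  by_cases hcase : 3 / 2 * θ ≤ b - a
  · have h1 := (hl2.trans centralAction_le_action).trans (hex 0 le_rfl (by linarith))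
    have hba : 0 < b - a := by linarith
    simp only [zero_div, zero_mul, zero_add, add_zero] at h1
    rw [ENNReal.ofReal_le_ofReal_iff (by positivity)] at h1
    have h2 := hkin _ hcase
    have h3 : 0 ≤ 3 / 2 * θ / (a - a₁ - 3 / 2 * θ) * E := by positivity
    have h4 : (b - a) * (m / d) ≤ (b - a + 3 / 2 * θ) * (m / d) := by gcongr; linarith
    linarith
  · have hβ : 0 ≤ 3 / 2 * θ - (b - a) := by linarith
    have h1 := (hl1.trans centralAction_le_action).trans (hex (3 / 2 * θ - (b - a)) hβ (by linarith))
    rw [show b - a + (3 / 2 * θ - (b - a)) = 3 / 2 * θ by ring] at h1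
    have hL' : 0 < a - a₁ - (3 / 2 * θ - (b - a)) := by linarith
    rw [ENNReal.ofReal_le_ofReal_iff (by positivity)] at h1
    have h2 := hkin _ le_rfl
    have h3 : (3 / 2 * θ - (b - a)) / (a - a₁ - (3 / 2 * θ - (b - a))) * E ≤
        3 / 2 * θ / (a - a₁ - 3 / 2 * θ) * E := by gcongr <;> linarith
    have h4 : 3 / 2 * θ * (m / d) ≤ (b - a + 3 / 2 * θ) * (m / d) := by gcongr; linarith
    have h5 : 3 / 2 * θ * (μ / ρ) = 3 / 2 * g := by rw [mul_assoc, hμρ]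
    linarith

end Exchange

/-! ### The lower bound for |z| -/

section Lower

variable {μ m T : ℝ} {q z : ℝ → ℂ} {A A₀ : Set ℂ}

/-- A path whose action does not allow it to stay `ρ`-close to the center on `[s, t₀]` and on
`[t₀, t]` crosses the circle of radius `ρ` on both intervals. -/
theorem exists_excursion {s t t₀ ρ E : ℝ} (hμ : 0 < μ) (hst : s ≤ t₀) (htt : t₀ ≤ t) (hE : 0 ≤ E)
    (hz : ContinuousOn (fun t => ‖z t‖) (Icc s t)) (hz0 : ‖z t₀‖ < ρ)
    (hact : action μ m q s t z ≤ ENNReal.ofReal E) (h1 : E < (t₀ - s) * (μ / ρ))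
    (h2 : E < (t - t₀) * (μ / ρ)) :
    ∃ a b, s ≤ a ∧ a < t₀ ∧ t₀ < b ∧ b ≤ t ∧ ‖z a‖ = ρ ∧ ‖z b‖ = ρ ∧
      (∀ u ∈ Icc a b, ‖z u‖ ≤ ρ) ∧ (b - a) * (μ / ρ) ≤ E := by
  have hbig : ∀ u v, s ≤ u → v ≤ t → u ≤ v → (∀ r ∈ Icc u v, ‖z r‖ ≤ ρ) →
      (v - u) * (μ / ρ) ≤ E := fun u v hu hv huv hr => by
    have h := (ofReal_mul_div_le_action (m := m) (q := q) hμ huv hr).trans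
      ((action_mono hu hv).trans hact)
    exact (ENNReal.ofReal_le_ofReal_iff hE).1 h
  obtain ⟨b, hb1, hb2, hzb, hzb'⟩ : ∃ b, t₀ < b ∧ b ≤ t ∧ ‖z b‖ = ρ ∧
      ∀ u ∈ Icc t₀ b, ‖z u‖ ≤ ρ := by
    by_cases h : ∃ u ∈ Icc t₀ t, ρ ≤ ‖z u‖
    · obtain ⟨u, hu, hu'⟩ := h
      obtain ⟨b, h1, h2, h3, h4⟩ := exists_first_hitting hu.1
        (hz.mono (Icc_subset_Icc hst hu.2)) hz0 hu'
      exact ⟨b, h1, h2.trans hu.2, h3, h4⟩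
    · push Not at h
      linarith [hbig t₀ t hst le_rfl htt fun u hu => (h u hu).le]
  obtain ⟨a, ha1, ha2, hza, hza'⟩ : ∃ a, s ≤ a ∧ a < t₀ ∧ ‖z a‖ = ρ ∧
      ∀ u ∈ Icc a t₀, ‖z u‖ ≤ ρ := by
    by_cases h : ∃ u ∈ Icc s t₀, ρ ≤ ‖z u‖
    · obtain ⟨u, hu, hu'⟩ := h
      obtain ⟨a, h1, h2, h3, h4⟩ := exists_last_hitting hu.2
        (hz.mono (Icc_subset_Icc hu.1 htt)) hu' hz0
      exact ⟨a, hu.1.trans h1, h2, h3, h4⟩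
    · push Not at h
      linarith [hbig s t₀ le_rfl htt hst fun u hu => (h u hu).le]
  have hle : ∀ u ∈ Icc a b, ‖z u‖ ≤ ρ := fun u hu => by
    rcases le_total u t₀ with h | h
    · exact hza' u ⟨hu.1, h⟩
    · exact hzb' u ⟨h, hu.2⟩
  exact ⟨a, b, ha1, ha2, hb1, hb2, hza, hzb, hle, hbig a b ha1 hb2 (ha2.trans hb1).le hle⟩

theorem norm_sub_le_of_action_le {s a r E : ℝ} (hsa : s ≤ a) (hE : 0 ≤ E) (hr : 0 ≤ r)
    (hz : MemH1 s a z) (hact : action μ m q s a z ≤ ENNReal.ofReal E)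
    (h : 2 * (a - s) * E ≤ r ^ 2) : ‖z a - z s‖ ≤ r := by
  rcases hsa.eq_or_lt with rfl | hlt
  · simpa using hr
  have h1 := (ofReal_sq_norm_sub_le_action (μ := μ) (m := m) (q := q) hlt hz).trans hact
  rw [ENNReal.ofReal_le_ofReal_iff hE, div_le_iff₀ (by linarith)] at h1
  exact le_of_sq_le_sq (by nlinarith) hr

/-- At the scale `x ^ 2`, `x = |t| ^ (1 / 3)`, a minimizer does not come close to the center. -/
theorem IsActionMinimizer.lt_norm (hμ : 0 < μ) (hm : 0 < m)
    (hz : IsActionMinimizer μ m q (-T) 0 A A₀ z) (hfin : action μ m q (-T) 0 z ≠ ⊤)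
    {x y κ C l : ℝ} (hx : 0 < x) (hy : 0 < y) (hκ : 0 < κ) (hC : 0 < C) (hl : 0 < l)
    (hxT : 2 * x ^ 3 ≤ T)
    (hq : ∀ t ∈ Icc (-(2 * x ^ 3)) 0, (q t).im = 0 ∧ (q t).re = -‖q t‖)
    (hanti : AntitoneOn (fun t => ‖q t‖) (Icc (-(2 * x ^ 3)) 0))
    (hqκ : κ * x ^ 2 ≤ ‖q (-(x ^ 3 / 2))‖)
    (hact : action μ m q (-(2 * x ^ 3)) 0 z ≤ ENNReal.ofReal (C * x))
    (hl2 : l ≤ 1 / 2) (hlκ : 2 * l * C ≤ (κ / 2) ^ 2)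
    (hyκ : y ^ 2 ≤ κ / 2) (hyC : 2 * C * y ^ 2 < μ) (hyl : 3 * y ^ 3 ≤ l * √μ)
    (hyμ : y * (y * (3 * C / (l * √μ)) + (C / μ + 3 / 2 * y / √μ) * (2 * m / κ)) <
      3 / 10 * √μ) :
    y ^ 2 * x ^ 2 / 20000 < ‖z (-x ^ 3)‖ := by
  by_contra! hclose
  have hx3 : 0 < x ^ 3 := by positivity
  set ρ := y ^ 2 * x ^ 2 with hρdef
  have hρ : 0 < ρ := by positivity
  have hzH := hz.1.1
  have hzcont : ContinuousOn (fun t => ‖z t‖) (Icc (-T) 0) := by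
    have := hzH.1.continuousOn.norm
    rwa [uIcc_of_le (by linarith)] at this
  -- Staying in the disc for time x³/2 would cost more than the whole available action.
  have hstay : C * x < x ^ 3 / 2 * (μ / ρ) := by
    have : x ^ 3 / 2 * (μ / ρ) = μ / (2 * y ^ 2) * x := by rw [hρdef]; field_simp
    rw [this]
    gcongr
    rw [lt_div_iff₀ (by positivity)]
    linarith
  obtain ⟨a, b, ha1, ha2, hb1, hb2, hza, hzb, hle, hba⟩ := exists_excursion (m := m) (q := q)
    (s := -(3 / 2 * x ^ 3)) (t := -(x ^ 3 / 2)) (t₀ := -x ^ 3) (ρ := ρ) (E := C * x) hμ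
    (by linarith) (by linarith) (by positivity)
    (hzcont.mono (Icc_subset_Icc (by linarith) (by linarith))) (by linarith)
    ((action_mono (by linarith) (by linarith)).trans hact)
    (by rwa [show -x ^ 3 - -(3 / 2 * x ^ 3) = x ^ 3 / 2 by ring])
    (by rwa [show -(x ^ 3 / 2) - -x ^ 3 = x ^ 3 / 2 by ring])
  -- The stretch that supplies the time. On it z moves by at most κx²/2, and it ends at distance ρ ≤
  -- κx²/2, so |z| ≤ κx² ≤ |q|.
  obtain ⟨a₁, ha₁⟩ : ∃ a₁, a₁ = a - l * x ^ 3 := ⟨_, rfl⟩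
  have haa : a - a₁ = l * x ^ 3 := by rw [ha₁]; ring
  have hlx : 0 < l * x ^ 3 := by positivity
  have hlx' : l * x ^ 3 ≤ 1 / 2 * x ^ 3 := by gcongr
  have ha₁' : -(2 * x ^ 3) ≤ a₁ := by linarith
  have hqlow : ∀ t ∈ Icc a₁ b, κ * x ^ 2 ≤ ‖q t‖ := fun t ht =>
    hqκ.trans (hanti ⟨by linarith [ht.1], by linarith [ht.2]⟩ ⟨by linarith, by linarith⟩
      (ht.2.trans hb2))
  have hρκ : ρ ≤ κ * x ^ 2 / 2 := by
    have : y ^ 2 * x ^ 2 ≤ κ / 2 * x ^ 2 := by gcongr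
    linarith
  have hzq : ∀ t ∈ Icc a₁ a, ‖z t‖ ≤ ‖q t‖ := fun t ht => by
    refine le_trans ?_ (hqlow t ⟨ht.1, by linarith [ht.2]⟩)
    have h3 : ‖z a - z t‖ ≤ κ / 2 * x ^ 2 := by
      refine norm_sub_le_of_action_le (μ := μ) (m := m) (q := q) (E := C * x) ht.2 (by positivity)
        (by positivity) (hzH.mono (by linarith [ht.1]) ht.2 (by linarith))
        ((action_mono (by linarith [ht.1]) (by linarith)).trans hact) ?_
      have h3 : 2 * (a - t) * (C * x) ≤ 2 * (l * x ^ 3) * (C * x) := by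
        gcongr; linarith [ht.1]
      have h4 : 2 * l * C * x ^ 4 ≤ (κ / 2) ^ 2 * x ^ 4 := by gcongr
      linarith
    have h4 := norm_sub_norm_le (z t) (z a)
    rw [norm_sub_rev, hza] at h4
    linarith
  have hsμ : 0 < √μ := Real.sqrt_pos.2 hμ
  have hsρ : √ρ = y * x := by
    rw [hρdef, ← mul_pow, Real.sqrt_sq (by positivity)]
  -- The Kepler time scale ρ^(3/2)/√μ of radius ρ.
  obtain ⟨θ, hθ⟩ : ∃ θ, θ = y ^ 3 * x ^ 3 / √μ := ⟨_, rfl⟩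
  have hθ0 : 0 < θ := by rw [hθ]; positivity
  have hθl : 3 * θ ≤ l * x ^ 3 := by
    have : 3 * y ^ 3 * x ^ 3 ≤ l * √μ * x ^ 3 := by gcongr
    rw [hθ, ← mul_div_assoc, div_le_iff₀ hsμ]
    linarith
  have hd : 0 < κ * x ^ 2 / 2 := by positivity
  have hθρ : θ * (√μ * √ρ) = ρ ^ 2 := by rw [hsρ, hθ, hρdef]; field_simp
  have key := hz.close_passage_estimate hμ hm hfin (a₁ := a₁) (d := κ * x ^ 2 / 2) (E := C * x)
    (by linarith) (by linarith) ha2 hb1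
    (by linarith) hρ hd (by positivity) hza hzb hclose hle
    (fun t ht => hq t ⟨by linarith [ht.1], by linarith [ht.2]⟩)
    (hanti.mono (Icc_subset_Icc ha₁' (by linarith))) hzq
    (fun t ht => by linarith [hqlow t ht])
    ((action_mono ha₁' (by linarith)).trans hact) hθ0 hθρ (by rw [haa]; linarith)
  rw [haa, hsρ] at key
  have hba' : b - a ≤ C * y ^ 2 / μ * x ^ 3 := by
    rw [← mul_div_assoc, div_le_iff₀ hρ, ← le_div_iff₀ hμ] at hba
    refine hba.trans (le_of_eq ?_)
    rw [hρdef]; field_simp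
  have h1 : 3 / 2 * θ / (l * x ^ 3 - 3 / 2 * θ) * (C * x) ≤
      3 / 2 * θ / (l * x ^ 3 / 2) * (C * x) := by
    gcongr; linarith
  have h2 : 3 / 2 * θ / (l * x ^ 3 / 2) * (C * x) = y ^ 2 * (3 * C / (l * √μ)) * (y * x) := by
    rw [hθ]; field_simp
  have h3 : (b - a + 3 / 2 * θ) * (m / (κ * x ^ 2 / 2)) ≤
      (C * y ^ 2 / μ * x ^ 3 + 3 / 2 * θ) * (m / (κ * x ^ 2 / 2)) := by gcongr
  have h4 : (C * y ^ 2 / μ * x ^ 3 + 3 / 2 * θ) * (m / (κ * x ^ 2 / 2)) =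
      y * ((C / μ + 3 / 2 * y / √μ) * (2 * m / κ)) * (y * x) := by
    rw [hθ]; field_simp
  have h5 : y * (y * (3 * C / (l * √μ)) + (C / μ + 3 / 2 * y / √μ) * (2 * m / κ)) * (y * x) <
      3 / 10 * √μ * (y * x) := by gcongr
  linarith

/-- A minimizer ending at the collision is at least of the order `|t| ^ (2 / 3)`. -/
theorem IsActionMinimizer.exists_lt_norm {ε : ℝ} (hμ : 0 < μ) (hm : 0 < m) (hT : 0 < T)
    (hq : ∀ t ∈ Icc (-T) 0, (q t).im = 0 ∧ (q t).re = -‖q t‖) (hεT : ε ≤ T)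
    (hlow : ∀ t ∈ Ico (-ε) 0, 9 / 4 * μ * t ^ 2 ≤ ‖q t‖ ^ 3)
    (hanti : AntitoneOn (fun t => ‖q t‖) (Icc (-ε) 0))
    (hz : IsActionMinimizer μ m q (-T) 0 A A₀ z) (hz0 : z 0 = 0) :
    ∃ k, 0 < k ∧ ∀ x, 0 < x → 2 * x ^ 3 ≤ ε → k * x ^ 2 < ‖z (-x ^ 3)‖ := by
  have hq' : ∀ t ∈ Icc (-T) 0, (q t).im = 0 ∧ (q t).re ≤ 0 := fun t ht =>
    ⟨(hq t ht).1, by rw [(hq t ht).2]; linarith [norm_nonneg (q t)]⟩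
  have hfin := hz.action_ne_top hμ hm hT hq' hz0
  obtain ⟨C₀, hC₀, hact⟩ := hz.exists_action_le hμ hm hT hq' hz0
  obtain ⟨c, hc, hc3⟩ := exists_cbrt (y := 2) two_pos
  -- At t = -x³/2 the bound (9/4)μt² equals (9/16)μx⁶.
  obtain ⟨κ, hκ, hκ3⟩ := exists_cbrt (y := 9 / 16 * μ) (by positivity)
  set C := C₀ * c with hCdef
  have hC : 0 < C := by positivity
  have hsμ : 0 < √μ := Real.sqrt_pos.2 hμ
  obtain ⟨l, hl, hl2, hlκ⟩ : ∃ l, 0 < l ∧ l ≤ 1 / 2 ∧ 2 * l * C ≤ (κ / 2) ^ 2 := by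
    refine ⟨min (1 / 2) ((κ / 2) ^ 2 / (2 * C)), by positivity, min_le_left _ _, ?_⟩
    have := min_le_right (1 / 2) ((κ / 2) ^ 2 / (2 * C))
    rw [le_div_iff₀ (by positivity)] at this
    linarith
  -- y is chosen after C, κ and l; every condition holds strictly at y = 0, hence for small positive
  -- y.
  obtain ⟨y, hy, hyκ, hyC, hyl, hyμ⟩ : ∃ y : ℝ, 0 < y ∧ y ^ 2 < κ / 2 ∧ 2 * C * y ^ 2 < μ ∧
      3 * y ^ 3 < l * √μ ∧
      y * (y * (3 * C / (l * √μ)) + (C / μ + 3 / 2 * y / √μ) * (2 * m / κ)) < 3 / 10 * √μ := by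
    have hev : ∀ {f : ℝ → ℝ} {r : ℝ}, Continuous f → f 0 < r → ∀ᶠ y in 𝓝[>] (0 : ℝ), f y < r :=
      fun hf h0 => (hf.continuousAt.eventually_lt_const h0).filter_mono nhdsWithin_le_nhds
    have h1 := hev (f := fun y => y ^ 2) (r := κ / 2) (by fun_prop) (by simp; positivity)
    have h2 := hev (f := fun y => 2 * C * y ^ 2) (r := μ) (by fun_prop) (by simpa using hμ)
    have h3 := hev (f := fun y => 3 * y ^ 3) (r := l * √μ) (by fun_prop) (by simp; positivity)
    have h4 := hev (f := fun y =>
      y * (y * (3 * C / (l * √μ)) + (C / μ + 3 / 2 * y / √μ) * (2 * m / κ))) (r := 3 / 10 * √μ)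
      (by fun_prop) (by simp; positivity)
    obtain ⟨y, hy, h⟩ := (eventually_mem_nhdsWithin.and (h1.and (h2.and (h3.and h4)))).exists
    exact ⟨y, hy, h.1, h.2.1, h.2.2.1, h.2.2.2⟩
  refine ⟨y ^ 2 / 20000, by positivity, fun x hx hxε => ?_⟩
  have hx3 : 0 < x ^ 3 := by positivity
  have hcx : (c * x) ^ 3 = 2 * x ^ 3 := by rw [mul_pow, hc3]
  have h := hz.lt_norm hμ hm hfin hx hy hκ hC hl (by linarith)
    (fun t ht => hq t ⟨by linarith [ht.1], ht.2⟩)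
    (hanti.mono (Icc_subset_Icc_left (by linarith))) ?_ ?_ hl2 hlκ hyκ.le hyC hyl.le hyμ
  · linarith
  · refine le_of_pow_le_pow_left₀ (n := 3) (by norm_num) (norm_nonneg _) ?_
    refine le_trans (le_of_eq ?_) (hlow _ ⟨by linarith, by linarith⟩)
    rw [mul_pow, hκ3]; ring
  · have := hact (c * x) (by positivity) (by rw [hcx]; linarith)
    rwa [hcx, ← mul_assoc] at this

end Lower

end OneCenterTwoBody

/-! ### Conclusion: comparison of |z| and |q| -/

theorem theorem3p1 (μ m T : ℝ) (hμ : 0 < μ) (hm : 0 < m) (hT : 0 < T)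
    (q : ℝ → ℂ) (hq : OneCenterTwoBody.IsCollisionKepler μ T q)
    (A A₀ : Set ℂ) (hA : IsClosed A) (hA₀ : IsClosed A₀) (hdisj : Disjoint A A₀)
    (hAsub : A ⊆ OneCenterTwoBody.closedUpperHalfPlane)
    (hA₀sub : A₀ ⊆ OneCenterTwoBody.closedUpperHalfPlane)
    (z : ℝ → ℂ) (hz : OneCenterTwoBody.IsActionMinimizer μ m q (-T) 0 A A₀ z)
    (hcoll : z 0 = 0) :
    ∃ ε c C : ℝ, 0 < ε ∧ ε < T ∧ 0 < c ∧ c < C ∧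
      ∀ t ∈ Set.Ioo (-ε) 0,
        c < OneCenterTwoBody.ratio z q t ∧ OneCenterTwoBody.ratio z q t < C := by
  obtain ⟨ε, hε, hεT, hbounds, hanti⟩ := hq.exists_bounds hμ hT
  have hsub : ∀ t ∈ Set.Icc (-T) 0, t ∈ Set.Icc (-T) T := fun t ht => ⟨ht.1, ht.2.trans hT.le⟩
  obtain ⟨K, hK, hupper⟩ := hz.exists_norm_le hμ hm hT
    (fun t ht => hq.mem_negReal t (hsub t ht)) hcoll
  obtain ⟨k, hk, hlower⟩ := hz.exists_lt_norm hμ hm hT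
    (fun t ht => ⟨(hq.mem_negReal t (hsub t ht)).1, hq.re_eq_neg_norm (hsub t ht)⟩) hεT.le
    (fun t ht => (hbounds t ht).1) hanti hcoll
  obtain ⟨κ₁, hκ₁, hκ₁3⟩ := OneCenterTwoBody.exists_cbrt (y := 9 / 4 * μ) (by positivity)
  obtain ⟨κ₂, hκ₂, hκ₂3⟩ := OneCenterTwoBody.exists_cbrt (y := 9 * μ) (by positivity)
  -- The lower bound looks back to time -2x³, hence ε/2. The extra terms in the upper constant only
  -- secure c < C and strictness.
  refine ⟨ε / 2, k / κ₂, K / κ₁ + k / κ₂ + 1, by linarith, by linarith, by positivity, ?_,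
    fun t ht => ?_⟩
  · have : 0 < K / κ₁ := by positivity
    linarith
  obtain ⟨x, hx, hxt⟩ := OneCenterTwoBody.exists_cbrt (y := -t) (by linarith [ht.2])
  obtain rfl : t = -x ^ 3 := by linarith
  have hx3 : 0 < x ^ 3 := by positivity
  have hx2 : 2 * x ^ 3 ≤ ε := by linarith [ht.1]
  obtain ⟨hb1, hb2⟩ := hbounds (-x ^ 3) ⟨by linarith, by linarith⟩
  have hq1 : κ₁ * x ^ 2 ≤ ‖q (-x ^ 3)‖ := by
    refine le_of_pow_le_pow_left₀ (n := 3) (by norm_num) (norm_nonneg _) (le_trans ?_ hb1)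
    rw [mul_pow, hκ₁3]
    exact le_of_eq (by ring)
  have hq2 : ‖q (-x ^ 3)‖ ≤ κ₂ * x ^ 2 := by
    refine le_of_pow_le_pow_left₀ (n := 3) (by norm_num) (by positivity) (hb2.trans ?_)
    rw [mul_pow, hκ₂3]
    exact le_of_eq (by ring)
  have hqpos : 0 < ‖q (-x ^ 3)‖ := lt_of_lt_of_le (by positivity) hq1
  have hu := hupper x hx (by linarith)
  have hl := hlower x hx hx2
  rw [OneCenterTwoBody.ratio]
  constructor
  · rw [lt_div_iff₀ hqpos]
    calc k / κ₂ * ‖q (-x ^ 3)‖ ≤ k / κ₂ * (κ₂ * x ^ 2) := by gcongr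
      _ = k * x ^ 2 := by field_simp
      _ < _ := hl
  · have h1 : ‖z (-x ^ 3)‖ / ‖q (-x ^ 3)‖ ≤ K / κ₁ := by
      rw [div_le_div_iff₀ hqpos hκ₁]
      calc ‖z (-x ^ 3)‖ * κ₁ ≤ K * x ^ 2 * κ₁ := by gcongr
        _ = K * (κ₁ * x ^ 2) := by ring
        _ ≤ _ := by gcongr
    have h2 : 0 < k / κ₂ := by positivity
    linarith
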